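/- Let $L<T<U$, $\sigma>0$, $\mu\in\mathbb R$, $n\ge 2$, and let $X_1,\dots,X_n$ be independent $N(\mu,\sigma^2)$ random variables. Put $\bar X=\frac1n\sum_i X_i$, $S_n^2=\frac1n\sum_i (X_i-\bar X)^2$, $d=(U-L)/2$, $D_u=U-T$, $D_l=T-L$, $d^*=\min\{D_u,D_l\}$, and, for $u,v\ge 0$, $$\hat A^*=\max\Big\{\tfrac{d^*(\bar X-T)}{D_u},\tfrac{d^*(T-\bar X)}{D_l}\Big\},\quad \hat A=\max\Big\{\tfrac{d(\bar X-T)}{D_u},\tfrac{d(T-\bar X)}{D_l}\Big\},\quad \hat C''_{p,n}(u,v)=\frac{d^*-u\hat A^*}{3\sqrt{S_n^2+v\hat A^2}}.$$ Let $D^*=\sqrt n\,d^*/\sigma$, $D=\sqrt n\,d/\sigma$, $\delta=\sqrt n(\mu-T)/\sigma$, $h=u\,d^*/d$, $Z=\sqrt n(\bar X-T)/\sigma$, $K=nS_n^2/\sigma^2$, $Y=[\max\{(d/D_u)Z,-(d/D_l)Z\}]^2$, and let $\phi$ be the standard normal density. (a) $K$ has the density $f_K$ of the $\chi^2_{n-1}$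 distribution, and $Y$ has the density $$f_Y(y)=\frac1{2\sqrt y}\Big(\frac{D_u}{d}\,\phi\Big(\frac{D_u}{d}\sqrt y-\delta\Big)+\frac{D_l}{d}\,\phi\Big(\frac{D_l}{d}\sqrt y+\delta\Big)\Big)\ (y>0),\qquad f_Y(y)=0\ (y\le 0).$$ (b) Let $u,v>0$, $K(x)=[D^*/(h+3x\sqrt v)]^2$ and $$J(x,t)=f_K\Big(\Big(\tfrac{D^*-h\sqrt{tK(x)}}{3x}\Big)^2-vtK(x)\Big)\,f_Y(tK(x))\,\frac{2K(x)}{x}\Big(\tfrac{D^*-h\sqrt{tK(x)}}{3x}\Big)^2 .$$ Then $\hat C''_{p,n}(u,v)$ has a density, equal to $\int_0^1 J(x,t)\,dt$ for $x>0$, to $-\int_1^\infty J(x,t)\,dt$ for $-h/(3\sqrt v)<x<0$, and to $0$ elsewhere; these integrals converge absolutely. (c) The statement in (b) remains true for $u>0,\ v=0$, with $-h/(3\sqrt v)$ read as $-\infty$, and for $u=0,\ v>0$, where the density is $0$ for $x<0$. (d) If $u>0$ and $v=0$, then $K(x)=[D^*/h]^2=[D/u]^2$, and $\hat C''_{p,n}(u,0)$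 has a density equal to $\int_0^1 J_1(x,t)\,dt$ for $x>0$ and to $-\int_1^\infty J_1(x,t)\,dt$ for $x<0$ (absolutely convergent integrals), where $$J_1(x,t)=f_K\Big(\Big(\tfrac{D^*(1-\sqrt t)}{3x}\Big)^2\Big)\,f_Y\Big(\Big(\tfrac Du\Big)^2t\Big)\,\frac2x\Big(\frac Du\Big)^2\Big(\tfrac{D^*(1-\sqrt t)}{3x}\Big)^2 .$$ (e) If $u=0$ and $v>0$, then $K(x)=[D^*/(3x\sqrt v)]^2$ for $x>0$, and $\hat C''_{p,n}(0,v)$ has a density equal to $\int_0^1 J_2(x,t)\,dt$ for $x>0$ (absolutely convergent integrals) and to $0$ for $x<0$, where $$J_2(x,t)=f_K\Big(\Big(\tfrac{D^*}{3x}\Big)^2(1-t)\Big)\,f_Y\Big(\Big(\tfrac{D^*}{3x}\Big)^2\frac tv\Big)\,\frac{2}{xv}\Big(\tfrac{D^*}{3x}\Big)^4 .$$ -/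

import Mathlib

open MeasureTheory ProbabilityTheory Set

noncomputable section

namespace Capability

/-- The mean of a sample `x` of size `n`. -/
def sampleMean {n : ℕ} (x : Fin n → ℝ) : ℝ := (∑ i, x i) / n

/-- The sample variance `S_n²`, with divisor `n`. -/
def sampleVar {n : ℕ} (x : Fin n → ℝ) : ℝ := (∑ i, (x i - sampleMean x) ^ 2) / n

/-- The half-length `d` of the tolerance interval `[L, U]`. -/
def halfLength (L U : ℝ) : ℝ := (U - L) / 2

/-- `d* = min {D_u, D_l}`, where `D_u = U - T` and `D_l = T - L`. -/
def dStar (L T U : ℝ) : ℝ := min (U - T) (T - L)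

/-- The estimator of `A* = max {d*(μ - T)/D_u, d*(T - μ)/D_l}`. -/
def AStarHat (L T U : ℝ) {n : ℕ} (x : Fin n → ℝ) : ℝ :=
  max (dStar L T U * (sampleMean x - T) / (U - T)) (dStar L T U * (T - sampleMean x) / (T - L))

/-- The estimator of `A = max {d(μ - T)/D_u, d(T - μ)/D_l}`. -/
def AHat (L T U : ℝ) {n : ℕ} (x : Fin n → ℝ) : ℝ :=
  max (halfLength L U * (sampleMean x - T) / (U - T))
    (halfLength L U * (T - sampleMean x) / (T - L))

/-- The estimator of the capability index
`(d* - u A*) / (3 √(σ² + v A²))` computed from the sample `x`. -/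
def indexHat (L T U u v : ℝ) {n : ℕ} (x : Fin n → ℝ) : ℝ :=
  (dStar L T U - u * AStarHat L T U x) / (3 * √(sampleVar x + v * AHat L T U x ^ 2))

/-- `Z = √n (x̄ - T) / σ`. -/
def ZStat (T σ : ℝ) {n : ℕ} (x : Fin n → ℝ) : ℝ := √n * (sampleMean x - T) / σ

/-- `K = n S_n² / σ²`. -/
def KStat (σ : ℝ) {n : ℕ} (x : Fin n → ℝ) : ℝ := n * sampleVar x / σ ^ 2

/-- `Y = [max {(d/D_u) Z, -(d/D_l) Z}]²`. -/
def YStat (L T U σ : ℝ) {n : ℕ} (x : Fin n → ℝ) : ℝ :=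
  (max (halfLength L U / (U - T) * ZStat T σ x) (-(halfLength L U / (T - L)) * ZStat T σ x)) ^ 2

/-- `D* = √n d* / σ`. -/
def DStar (n : ℕ) (L T U σ : ℝ) : ℝ := √n * dStar L T U / σ

/-- `D = √n d / σ`. -/
def DBig (n : ℕ) (L U σ : ℝ) : ℝ := √n * halfLength L U / σ

/-- `δ = √n (μ - T) / σ`. -/
def delta (n : ℕ) (T μ σ : ℝ) : ℝ := √n * (μ - T) / σ

/-- `h = u d* / d`. -/
def hCoef (L T U u : ℝ) : ℝ := u * dStar L T U / halfLength L U

/-- The standard normal density `φ`. -/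
def stdNormalPDF (x : ℝ) : ℝ := gaussianPDFReal 0 1 x

/-- The density of the chi-squared distribution with `n - 1` degrees of freedom, that is, of the
gamma distribution with shape `(n - 1) / 2` and rate `1 / 2`. -/
def fK (n : ℕ) (x : ℝ) : ℝ := gammaPDFReal (((n : ℝ) - 1) / 2) (1 / 2) x

/-- The function `f_Y`. -/
def fY (n : ℕ) (L T U μ σ : ℝ) (y : ℝ) : ℝ :=
  if 0 < y then
    1 / (2 * √y) *
      ((U - T) / halfLength L U *
          stdNormalPDF ((U - T) / halfLength L U * √y - delta n T μ σ) +
        (T - L) / halfLength L U *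
          stdNormalPDF ((T - L) / halfLength L U * √y + delta n T μ σ))
  else 0

/-- `K(x) = [D* / (h + 3 x √v)]²`. -/
def Kfun (n : ℕ) (L T U σ u v : ℝ) (x : ℝ) : ℝ :=
  (DStar n L T U σ / (hCoef L T U u + 3 * x * √v)) ^ 2

/-- The integrand `J(x, t)`. -/
def J (n : ℕ) (L T U μ σ u v : ℝ) (x t : ℝ) : ℝ :=
  fK n (((DStar n L T U σ - hCoef L T U u * √(t * Kfun n L T U σ u v x)) / (3 * x)) ^ 2
      - v * t * Kfun n L T U σ u v x)
    * fY n L T U μ σ (t * Kfun n L T U σ u v x)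
    * (2 * Kfun n L T U σ u v x / x)
    * ((DStar n L T U σ - hCoef L T U u * √(t * Kfun n L T U σ u v x)) / (3 * x)) ^ 2

/-- The integrand `J₁(x, t)` of the case `v = 0`. -/
def J₁ (n : ℕ) (L T U μ σ u : ℝ) (x t : ℝ) : ℝ :=
  fK n ((DStar n L T U σ * (1 - √t) / (3 * x)) ^ 2)
    * fY n L T U μ σ ((DBig n L U σ / u) ^ 2 * t)
    * (2 / x) * (DBig n L U σ / u) ^ 2
    * (DStar n L T U σ * (1 - √t) / (3 * x)) ^ 2

/-- The integrand `J₂(x, t)` of the case `u = 0`. -/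
def J₂ (n : ℕ) (L T U μ σ v : ℝ) (x t : ℝ) : ℝ :=
  fK n ((DStar n L T U σ / (3 * x)) ^ 2 * (1 - t))
    * fY n L T U μ σ ((DStar n L T U σ / (3 * x)) ^ 2 * (t / v))
    * (2 / (x * v))
    * (DStar n L T U σ / (3 * x)) ^ 4

/-- The left end point `-h / (3 √v)`, read as `-∞` when `v = 0`. -/
def leftEnd (h v : ℝ) : EReal := if v = 0 then ⊥ else ((-h / (3 * √v) : ℝ) : EReal)

/-- The function equal to `∫₀¹ I(x, t) dt` for `x > 0`, to `-∫₁^∞ I(x, t) dt` for `a < x < 0`, and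
to `0` elsewhere. -/
def splitIntegral (a : EReal) (I : ℝ → ℝ → ℝ) (x : ℝ) : ℝ :=
  open scoped Classical in
  if 0 < x then ∫ t in Ioo (0 : ℝ) 1, I x t
  else if a < (x : EReal) ∧ x < 0 then -∫ t in Ioi (1 : ℝ), I x t
  else 0

/-- The real random variable `W` has the probability density `f` with respect to Lebesgue
measure. -/
def HasDensity {Ω : Type*} [MeasurableSpace Ω] (P : Measure Ω) (W : Ω → ℝ) (f : ℝ → ℝ) : Prop :=
  AEMeasurable f volume ∧ (∀ x, 0 ≤ f x) ∧
    HasLaw W (volume.withDensity fun x => ENNReal.ofReal (f x)) P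

/-- The integrals which define `splitIntegral a I` converge, and this function is a density
of `W`. -/
def HasSplitIntegralDensity {Ω : Type*} [MeasurableSpace Ω] (P : Measure Ω) (W : Ω → ℝ)
    (a : EReal) (I : ℝ → ℝ → ℝ) : Prop :=
  (∀ x : ℝ, 0 < x → IntegrableOn (I x) (Ioo 0 1)) ∧
  (∀ x : ℝ, a < (x : EReal) → x < 0 → IntegrableOn (I x) (Ioi 1)) ∧
  HasDensity P W (splitIntegral a I)

end Capability

end

open Capability

namespace Capability

open scoped ENNReal

/-! Both estimated asymmetry terms are multiples of one nonnegative maximum, so scaling by `√n / σ`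
turns the index into `(D* - h√Y) / (3√(K + vY))` (`indexHat_eq`). In an orthonormal basis containing
the constant unit vector, the standardized sample is again standard Gaussian; the coordinate along
that vector gives `Z`, the squares of the others add up to `K`. Hence `K` and `Y` are independent
(`hasLaw_ZStat_KStat`), and `Y` is a folded square of `Z` (`hasLaw_sq_max`).

For fixed `Y = y`, the substitution `k = (w / (3x))² - vy` with `w = D* - h√y` has Jacobian `(2/|x|)
(w / (3x))²`; Tonelli then yields a density with values in `[0, ∞]` (`hasLaw_ratio`). With `e = h +
3x√v`, `k` factors so that its positivity means that `D* - e√y` has the sign of `x`. If `e > 0`,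
this is `y < K(x)` for `x > 0` and `y > K(x)` for `x < 0`; if `e ≤ 0`, no `y` remains. Putting `y =
t K(x)` produces the ranges `(0, 1)` and `(1, ∞)` (`ratioDensity_eq_lintegral_ratioRange`), and the
factor `2/x` in `J` explains the minus sign.

Absolute convergence comes from `norm_ratioKernel_le`: the integrand is at most a multiple of
`exp(-bt) / (√t √|1 - t|)`. -/

/-! ### Gamma laws and their moment generating functions -/

/-- Two probability measures on `ℝ` with the same moment generating function, finite near `0`, are
equal. -/
lemma ext_of_mgf_id_eq {μ ν : Measure ℝ} [IsProbabilityMeasure μ] [IsProbabilityMeasure ν]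
    (h0 : 0 ∈ interior (integrableExpSet id μ)) (h : mgf id μ = mgf id ν) : μ = ν := by
  refine Measure.ext_of_charFun (funext fun t => ?_)
  rw [← complexMGF_id_mul_I, ← complexMGF_id_mul_I]
  exact eqOn_complexMGF_of_mgf h (by simpa using h0)

lemma mgf_id_gammaMeasure_eq_integral (a r t : ℝ) :
    mgf id (gammaMeasure a r) t = ∫ x, (gammaPDF a r x).toReal * Real.exp (t * x) := by
  have hm : Measurable (gammaPDF a r) := (measurable_gammaPDFReal a r).ennreal_ofReal
  simp only [mgf, gammaMeasure, id]
  rw [integral_withDensity_eq_integral_toReal_smul hm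
    (ae_of_all _ fun _ => ENNReal.ofReal_lt_top)]
  simp

lemma toReal_gammaPDF {a r : ℝ} (ha : 0 < a) (hr : 0 < r) (x : ℝ) :
    (gammaPDF a r x).toReal = gammaPDFReal a r x :=
  ENNReal.toReal_ofReal (gammaPDFReal_nonneg ha hr x)

/-- Exponential tilting only shifts the rate of a gamma density, so the moment generating function
follows from total mass one. -/
lemma gammaPDFReal_mul_exp {a r t : ℝ} (hr : 0 < r) (ht : t < r) (x : ℝ) :
    gammaPDFReal a r x * Real.exp (t * x) = (r / (r - t)) ^ a * gammaPDFReal a (r - t) x := by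
  have hrt : 0 < r - t := sub_pos.2 ht
  unfold gammaPDFReal
  split_ifs
  · have : Real.exp (-((r - t) * x)) = Real.exp (-(r * x)) * Real.exp (t * x) := by
      rw [← Real.exp_add]; ring_nf
    rw [this, Real.div_rpow hr.le hrt.le]
    have := (Real.rpow_pos_of_pos hrt a).ne'
    field_simp
  · simp

lemma mgf_id_gammaMeasure_of_lt {a r t : ℝ} (ha : 0 < a) (hr : 0 < r) (ht : t < r) :
    mgf id (gammaMeasure a r) t = (r / (r - t)) ^ a := by
  have hrt : 0 < r - t := sub_pos.2 ht
  rw [mgf_id_gammaMeasure_eq_integral]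
  simp_rw [toReal_gammaPDF ha hr, gammaPDFReal_mul_exp hr ht]
  rw [integral_const_mul, integral_eq_lintegral_of_nonneg_ae
    (ae_of_all _ fun x => gammaPDFReal_nonneg ha hrt x)
    (measurable_gammaPDFReal _ _).aestronglyMeasurable]
  have := lintegral_gammaPDF_eq_one ha hrt
  unfold gammaPDF at this
  simp [this]

/-- From the rate onwards the integrand dominates a multiple of `x ^ (a - 1)`, which is not
integrable on the half-line; the value is the default 0 of a divergent integral. It is needed
because moment generating functions are compared at every real `t`. -/
lemma mgf_id_gammaMeasure_of_le {a r t : ℝ} (ha : 0 < a) (hr : 0 < r) (ht : r ≤ t) :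
    mgf id (gammaMeasure a r) t = 0 := by
  rw [mgf_id_gammaMeasure_eq_integral]
  simp_rw [toReal_gammaPDF ha hr]
  refine integral_undef fun hI => not_integrableOn_Ioi_rpow (a - 1) ?_
  set c : ℝ := r ^ a / Real.Gamma a
  have hc : 0 < c := div_pos (Real.rpow_pos_of_pos hr a) (Real.Gamma_pos_of_pos ha)
  refine ((hI.const_mul c⁻¹).integrableOn (s := Ioi 0)).mono'
    (Measurable.aestronglyMeasurable (by fun_prop)) ?_
  refine (ae_restrict_mem measurableSet_Ioi).mono fun x (hx : 0 < x) => ?_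
  rw [Real.norm_of_nonneg (by positivity), gammaPDFReal, if_pos hx.le]
  have h1 : (1 : ℝ) ≤ Real.exp (-(r * x)) * Real.exp (t * x) := by
    rw [← Real.exp_add]
    exact Real.one_le_exp (by nlinarith)
  calc x ^ (a - 1) = x ^ (a - 1) * 1 := (mul_one _).symm
    _ ≤ x ^ (a - 1) * (Real.exp (-(r * x)) * Real.exp (t * x)) := by gcongr
    _ = c⁻¹ * (c * x ^ (a - 1) * Real.exp (-(r * x)) * Real.exp (t * x)) := by field_simp

lemma zero_mem_interior_integrableExpSet_gammaMeasure {a r : ℝ} (ha : 0 < a) (hr : 0 < r) :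
    0 ∈ interior (integrableExpSet id (gammaMeasure a r)) := by
  have := isProbabilityMeasure_gammaMeasure ha hr
  refine mem_interior.2 ⟨Iio r, fun t (ht : t < r) => ?_, isOpen_Iio, hr⟩
  have hpos : 0 < mgf id (gammaMeasure a r) t := by
    rw [mgf_id_gammaMeasure_of_lt ha hr ht]
    exact Real.rpow_pos_of_pos (div_pos hr (sub_pos.2 ht)) a
  -- Without integrability the moment generating function would take its default value 0.
  by_contra hcon
  exact hpos.ne' (mgf_undef hcon)

lemma hasLaw_sum_gammaMeasure {Ω ι : Type*} [MeasurableSpace Ω] {P : Measure Ω} {V : ι → Ω → ℝ}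
    {a r : ℝ} (ha : 0 < a) (hr : 0 < r) (hV : ∀ i, HasLaw (V i) (gammaMeasure a r) P)
    (hind : iIndepFun V P) {s : Finset ι} (hs : s.Nonempty) :
    HasLaw (∑ i ∈ s, V i) (gammaMeasure (s.card * a) r) P := by
  have hPr : IsProbabilityMeasure P := hind.isProbabilityMeasure
  have hm : AEMeasurable (∑ i ∈ s, V i) P :=
    Finset.aemeasurable_sum s fun i _ => (hV i).aemeasurable
  have hsa : 0 < (s.card : ℝ) * a := mul_pos (by exact_mod_cast hs.card_pos) ha
  have := isProbabilityMeasure_gammaMeasure hsa hr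
  have := Measure.isProbabilityMeasure_map hm
  refine ⟨hm, (ext_of_mgf_id_eq
    (zero_mem_interior_integrableExpSet_gammaMeasure hsa hr) (funext fun t => ?_)).symm⟩
  rw [mgf_id_map hm, hind.mgf_sum₀ (fun i => (hV i).aemeasurable)]
  have h1 (i : ι) : mgf (V i) P t = mgf id (gammaMeasure a r) t := by
    rw [← (hV i).map_eq, mgf_id_map (hV i).aemeasurable]
  simp_rw [h1, Finset.prod_const]
  rcases lt_or_ge t r with ht | ht
  · rw [mgf_id_gammaMeasure_of_lt ha hr ht, mgf_id_gammaMeasure_of_lt hsa hr ht, mul_comm,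
      Real.rpow_mul_natCast (div_pos hr (sub_pos.2 ht)).le]
  · rw [mgf_id_gammaMeasure_of_le ha hr ht, mgf_id_gammaMeasure_of_le hsa hr ht,
      zero_pow hs.card_ne_zero]

/-! ### Folded squares and the density of `Y` -/

lemma lintegral_eq_lintegral_Ioi_add_lintegral_Iio (F : ℝ → ℝ≥0∞) :
    ∫⁻ z, F z = (∫⁻ z in Ioi 0, F z) + ∫⁻ z in Iio 0, F z := by
  rw [← lintegral_add_compl F (measurableSet_Ioi (a := (0 : ℝ))), compl_Ioi,
    setLIntegral_congr (Iio_ae_eq_Iic (a := (0 : ℝ)))]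

lemma image_sq_mul_Ioi {α : ℝ} (hα : 0 < α) : (fun z => (α * z) ^ 2) '' Ioi 0 = Ioi 0 := by
  ext y
  simp only [mem_image, mem_Ioi]
  constructor
  · rintro ⟨z, hz, rfl⟩; positivity
  · intro hy
    refine ⟨√y / α, by positivity, ?_⟩
    rw [mul_div_cancel₀ _ hα.ne', Real.sq_sqrt hy.le]

lemma setLIntegral_Ioi_comp_sq_mul {α : ℝ} (hα : 0 < α) (q : ℝ → ℝ) (g : ℝ → ℝ≥0∞) :
    ∫⁻ z in Ioi 0, ENNReal.ofReal (q z) * g ((α * z) ^ 2) =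
      ∫⁻ y in Ioi 0, ENNReal.ofReal (1 / (2 * √y) * (α⁻¹ * q (α⁻¹ * √y))) * g y := by
  have hinj : InjOn (fun z : ℝ => (α * z) ^ 2) (Ioi 0) := by
    intro z (hz : 0 < z) w (hw : 0 < w) h
    have := (pow_left_inj₀ (by positivity) (by positivity) two_ne_zero).1 h
    exact mul_left_cancel₀ hα.ne' this
  have hderiv : ∀ z ∈ Ioi (0 : ℝ),
      HasDerivWithinAt (fun z : ℝ => (α * z) ^ 2) (2 * α ^ 2 * z) (Ioi 0) z := by
    intro z _
    have := (((hasDerivAt_id z).const_mul α).fun_pow 2).hasDerivWithinAt (s := Ioi 0)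
    refine this.congr_deriv ?_
    simp only [id]
    ring
  have himage := lintegral_image_eq_lintegral_abs_deriv_mul measurableSet_Ioi hderiv hinj
    fun y => ENNReal.ofReal (1 / (2 * √y) * (α⁻¹ * q (α⁻¹ * √y))) * g y
  rw [image_sq_mul_Ioi hα] at himage
  rw [himage]
  refine setLIntegral_congr_fun measurableSet_Ioi fun z (hz : 0 < z) => ?_
  rw [Real.sqrt_sq (by positivity), ← mul_assoc, ← ENNReal.ofReal_mul (abs_nonneg _),
    abs_of_pos (by positivity), inv_mul_cancel_left₀ hα.ne']
  congr 2
  field_simp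

lemma setLIntegral_Iio_eq_Ioi_comp_neg (F : ℝ → ℝ≥0∞) :
    ∫⁻ z in Iio 0, F z = ∫⁻ z in Ioi 0, F (-z) := by
  have := (Measure.measurePreserving_neg (volume : Measure ℝ)).setLIntegral_comp_preimage_emb
    (Homeomorph.neg ℝ).measurableEmbedding F (Iio 0)
  rw [← this]
  simp

/-- The law of `(max {α Z, -β Z})²` for a random variable `Z` with density `q`. -/
lemma hasLaw_sq_max {Ω : Type*} [MeasurableSpace Ω] {P : Measure Ω} {Z : Ω → ℝ} {q : ℝ → ℝ}
    {α β : ℝ} (hα : 0 < α) (hβ : 0 < β) (hq : Measurable q) (hq0 : ∀ z, 0 ≤ q z)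
    (hZ : HasLaw Z (volume.withDensity fun z => ENNReal.ofReal (q z)) P) :
    HasLaw (fun ω => max (α * Z ω) (-β * Z ω) ^ 2)
      (volume.withDensity fun y => ENNReal.ofReal
        (if 0 < y then 1 / (2 * √y) * (α⁻¹ * q (α⁻¹ * √y) + β⁻¹ * q (-(β⁻¹ * √y))) else 0)) P := by
  have hm : Measurable fun z : ℝ => max (α * z) (-β * z) ^ 2 := by fun_prop
  refine HasLaw.fun_comp (Y := fun z => max (α * z) (-β * z) ^ 2) ⟨hm.aemeasurable, ?_⟩ hZ
  refine Measure.ext_of_lintegral _ fun g hg => ?_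
  rw [lintegral_map hg hm, lintegral_withDensity_eq_lintegral_mul _ hq.ennreal_ofReal
    (g := fun z => g (max (α * z) (-β * z) ^ 2)) (hg.comp hm),
    lintegral_withDensity_eq_lintegral_mul _ ?_ hg]
  swap
  · exact (Measurable.ite measurableSet_Ioi (by fun_prop) measurable_const).ennreal_ofReal
  simp only [Pi.mul_apply]
  -- Each sign of `z` selects one branch of the maximum, and the square is injective on each branch.
  rw [lintegral_eq_lintegral_Ioi_add_lintegral_Iio, lintegral_eq_lintegral_Ioi_add_lintegral_Iio
    (fun y => ENNReal.ofReal (ite (0 < y) _ _) * _), setLIntegral_Iio_eq_Ioi_comp_neg]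
  have h0 : ∫⁻ y in Iio (0 : ℝ), ENNReal.ofReal (if 0 < y then
      1 / (2 * √y) * (α⁻¹ * q (α⁻¹ * √y) + β⁻¹ * q (-(β⁻¹ * √y))) else 0) * g y = 0 := by
    rw [setLIntegral_congr_fun (g := fun _ => 0) measurableSet_Iio, lintegral_zero]
    intro y (hy : y < 0)
    simp [hy.not_gt]
  rw [h0, add_zero]
  have h1 : ∫⁻ z in Ioi (0 : ℝ), ENNReal.ofReal (q z) * g (max (α * z) (-β * z) ^ 2) =
      ∫⁻ y in Ioi 0, ENNReal.ofReal (1 / (2 * √y) * (α⁻¹ * q (α⁻¹ * √y))) * g y := by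
    rw [← setLIntegral_Ioi_comp_sq_mul hα]
    refine setLIntegral_congr_fun measurableSet_Ioi fun z (hz : 0 < z) => ?_
    rw [max_eq_left (by nlinarith [mul_pos hα hz, mul_pos hβ hz])]
  have h2 : ∫⁻ z in Ioi (0 : ℝ), ENNReal.ofReal (q (-z)) * g (max (α * -z) (-β * -z) ^ 2) =
      ∫⁻ y in Ioi 0, ENNReal.ofReal (1 / (2 * √y) * (β⁻¹ * q (-(β⁻¹ * √y)))) * g y := by
    rw [← setLIntegral_Ioi_comp_sq_mul hβ fun z => q (-z)]
    refine setLIntegral_congr_fun measurableSet_Ioi fun z (hz : 0 < z) => ?_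
    rw [max_eq_right (by nlinarith [mul_pos hα hz, mul_pos hβ hz]), neg_mul_neg]
  rw [h1, h2, ← lintegral_add_left (by fun_prop)]
  refine setLIntegral_congr_fun measurableSet_Ioi fun y (hy : 0 < y) => ?_
  rw [if_pos hy, mul_add, ENNReal.ofReal_add, add_mul]
  · exact mul_nonneg (by positivity) (mul_nonneg (by positivity) (hq0 _))
  · exact mul_nonneg (by positivity) (mul_nonneg (by positivity) (hq0 _))

lemma hasLaw_gaussianReal_withDensity {Ω : Type*} [MeasurableSpace Ω] {P : Measure Ω} {Z : Ω → ℝ}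
    {m : ℝ} (hZ : HasLaw Z (gaussianReal m 1) P) :
    HasLaw Z (volume.withDensity fun z => ENNReal.ofReal (gaussianPDFReal m 1 z)) P := by
  rw [gaussianReal_of_var_ne_zero _ one_ne_zero] at hZ
  exact hZ

lemma gaussianPDFReal_eq_stdNormalPDF (m x : ℝ) :
    gaussianPDFReal m 1 x = stdNormalPDF (x - m) := by
  simp [stdNormalPDF, gaussianPDFReal]

lemma stdNormalPDF_neg (x : ℝ) : stdNormalPDF (-x) = stdNormalPDF x := by
  simp [stdNormalPDF, gaussianPDFReal]

/-- The square of a standard normal variable has the gamma distribution with shape and rate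
`1 / 2`. -/
lemma hasLaw_sq_of_gaussianReal {Ω : Type*} [MeasurableSpace Ω] {P : Measure Ω} {Z : Ω → ℝ}
    (hZ : HasLaw Z (gaussianReal 0 1) P) :
    HasLaw (fun ω => Z ω ^ 2) (gammaMeasure (1 / 2) (1 / 2)) P := by
  have h := hasLaw_sq_max one_pos one_pos (measurable_gaussianPDFReal 0 1)
    (gaussianPDFReal_nonneg 0 1) (hasLaw_gaussianReal_withDensity hZ)
  have h1 : (fun ω => max (1 * Z ω) (-1 * Z ω) ^ 2) = fun ω => Z ω ^ 2 := by
    funext ω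
    rw [one_mul, neg_one_mul]
    exact sq_abs (Z ω)
  rw [h1] at h
  suffices gammaMeasure (1 / 2) (1 / 2) = _ by rw [this]; exact h
  refine withDensity_congr_ae ?_
  -- One density is cut off by `0 ≤ y` and the other by `0 < y`, so they are compared away from the
  -- origin.
  have hne : ∀ᵐ y : ℝ, y ≠ 0 := by simp [ae_iff]
  refine hne.mono fun y hy => ?_
  simp only [gammaPDF]
  congr 1
  unfold gammaPDFReal
  rcases hy.lt_or_gt with hy | hy
  · rw [if_neg hy.not_ge, if_neg hy.not_gt]
  · rw [if_pos hy.le, if_pos hy]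
    simp only [gaussianPDFReal, inv_one, one_mul, sub_zero, neg_sq, Real.sq_sqrt hy.le,
      NNReal.coe_one, mul_one]
    rw [Real.Gamma_one_half_eq, show (1 / 2 - 1 : ℝ) = -(1 / 2) by norm_num,
      Real.rpow_neg hy.le, ← Real.sqrt_eq_rpow, ← Real.sqrt_eq_rpow,
      Real.sqrt_mul two_pos.le, show -(1 / 2 * y) = -y / 2 by ring]
    rw [Real.sqrt_div one_pos.le, Real.sqrt_one]
    field_simp
    norm_num

lemma fY_eq_ite_gaussianPDFReal (n : ℕ) (L T U μ σ : ℝ) (y : ℝ) :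
    fY n L T U μ σ y = if 0 < y then 1 / (2 * √y) *
      ((halfLength L U / (U - T))⁻¹ *
          gaussianPDFReal (delta n T μ σ) 1 ((halfLength L U / (U - T))⁻¹ * √y) +
        (halfLength L U / (T - L))⁻¹ *
          gaussianPDFReal (delta n T μ σ) 1 (-((halfLength L U / (T - L))⁻¹ * √y))) else 0 := by
  simp only [fY, inv_div, gaussianPDFReal_eq_stdNormalPDF]
  rw [← stdNormalPDF_neg ((T - L) / halfLength L U * √y + delta n T μ σ), neg_add']

lemma hasLaw_YStat {Ω : Type*} [MeasurableSpace Ω] {P : Measure Ω}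
    {n : ℕ} {L T U μ σ : ℝ} (hLT : L < T) (hTU : T < U) {X : Fin n → Ω → ℝ}
    (hZ : HasLaw (fun ω => ZStat T σ fun i => X i ω) (gaussianReal (delta n T μ σ) 1) P) :
    HasLaw (fun ω => YStat L T U σ fun i => X i ω)
      (volume.withDensity fun y => ENNReal.ofReal (fY n L T U μ σ y)) P := by
  have hd : 0 < halfLength L U := by unfold halfLength; linarith
  have h := hasLaw_sq_max (div_pos hd (sub_pos.2 hTU)) (div_pos hd (sub_pos.2 hLT))
    (measurable_gaussianPDFReal _ 1) (gaussianPDFReal_nonneg _ 1)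
    (hasLaw_gaussianReal_withDensity hZ)
  simp_rw [fY_eq_ite_gaussianPDFReal]
  exact h

lemma fY_nonneg {n : ℕ} {L T U μ σ : ℝ} (hLT : L < T) (hTU : T < U) (y : ℝ) :
    0 ≤ fY n L T U μ σ y := by
  have hd : 0 < halfLength L U := by unfold halfLength; linarith
  have h1 := sub_pos.2 hLT
  have h2 := sub_pos.2 hTU
  have h3 (x : ℝ) : 0 ≤ stdNormalPDF x := gaussianPDFReal_nonneg 0 1 x
  unfold fY
  split_ifs
  · exact mul_nonneg (by positivity) (add_nonneg (mul_nonneg (by positivity) (h3 _))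
      (mul_nonneg (by positivity) (h3 _)))
  · exact le_rfl

lemma measurable_fY (n : ℕ) (L T U μ σ : ℝ) : Measurable (fY n L T U μ σ) := by
  have : Measurable stdNormalPDF := measurable_gaussianPDFReal 0 1
  unfold fY
  exact Measurable.ite measurableSet_Ioi (by fun_prop) measurable_const

/-! ### Independence of sample mean and sample variance -/

/-- The coordinates, in an orthonormal basis, of a vector of independent standard normal variables
are independent standard normal variables. -/
lemma iIndepFun_repr_of_gaussianReal {Ω ι : Type*} [MeasurableSpace Ω] {P : Measure Ω} [Fintype ι]
    {N : ι → Ω → ℝ} (hN : ∀ i, HasLaw (N i) (gaussianReal 0 1) P) (hind : iIndepFun N P)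
    (b : OrthonormalBasis ι ℝ (EuclideanSpace ℝ ι)) :
    (∀ i, HasLaw (fun ω => b.repr (WithLp.toLp 2 fun j => N j ω) i) (gaussianReal 0 1) P) ∧
      iIndepFun (fun i ω => b.repr (WithLp.toLp 2 fun j => N j ω) i) P := by
  have hPr : IsProbabilityMeasure P := hind.isProbabilityMeasure
  have h1 := iIndepFun.hasLaw_pi hN hind
  have h2 : HasLaw (WithLp.toLp 2) (stdGaussian (EuclideanSpace ℝ ι))
      (Measure.pi fun _ : ι => gaussianReal 0 1) :=
    ⟨by fun_prop, map_pi_eq_stdGaussian⟩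
  -- Rotation invariance of the standard Gaussian is the essential input; the neighbouring laws only
  -- pass between the product space and Euclidean space.
  have h3 : HasLaw b.repr (stdGaussian (EuclideanSpace ℝ ι)) (stdGaussian (EuclideanSpace ℝ ι)) :=
    ⟨by fun_prop, stdGaussian_map b.repr⟩
  have h4 : HasLaw (WithLp.ofLp : EuclideanSpace ℝ ι → ι → ℝ)
      (Measure.pi fun _ : ι => gaussianReal 0 1) (stdGaussian (EuclideanSpace ℝ ι)) := by
    refine ⟨by fun_prop, ?_⟩
    rw [← map_pi_eq_stdGaussian, Measure.map_map (by fun_prop) (by fun_prop)]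
    exact Measure.map_id
  have h5 : HasLaw (fun ω i => b.repr (WithLp.toLp 2 fun j => N j ω) i)
      (Measure.pi fun _ : ι => gaussianReal 0 1) P := h4.comp (h3.comp (h2.comp h1))
  have h6 (i : ι) :
      HasLaw (fun ω => b.repr (WithLp.toLp 2 fun j => N j ω) i) (gaussianReal 0 1) P :=
    (measurePreserving_eval (fun _ : ι => gaussianReal 0 1) i).hasLaw.comp h5
  exact ⟨h6, (iIndepFun_iff_hasLaw_pi_pi h6).2 h5⟩

/-- The coordinate along this constant unit vector is the sum divided by `√n`, that is, the
normalized sample mean. -/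
lemma exists_orthonormalBasis_const {n : ℕ} (i₀ : Fin n) :
    ∃ b : OrthonormalBasis (Fin n) ℝ (EuclideanSpace ℝ (Fin n)),
      ∀ j, b i₀ j = (√n)⁻¹ := by
  have hn : (0 : ℝ) < n := by exact_mod_cast i₀.pos
  let e : EuclideanSpace ℝ (Fin n) := WithLp.toLp 2 fun _ => (√n)⁻¹
  have he : ‖e‖ = 1 := by
    simp only [e, EuclideanSpace.norm_eq]
    simp [Real.sq_sqrt hn.le, hn.ne']
  have horth : Orthonormal ℝ (({i₀} : Set (Fin n)).domRestrict fun _ => e) := by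
    refine ⟨fun _ => he, fun i j hij => ?_⟩
    exact absurd (Subsingleton.elim i j) hij
  obtain ⟨b, hb⟩ := horth.exists_orthonormalBasis_extension_of_card_eq (by simp)
  refine ⟨b, fun j => ?_⟩
  rw [hb i₀ (mem_singleton i₀)]

lemma sum_sq_repr {ι : Type*} [Fintype ι] (b : OrthonormalBasis ι ℝ (EuclideanSpace ℝ ι))
    (w : ι → ℝ) : ∑ i, (b.repr (WithLp.toLp 2 w) i) ^ 2 = ∑ i, w i ^ 2 := by
  rw [← EuclideanSpace.real_norm_sq_eq, b.repr.norm_map, EuclideanSpace.real_norm_sq_eq]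

lemma sum_sq_sub_mean {n : ℕ} (hn : n ≠ 0) (w : Fin n → ℝ) :
    ∑ i, (w i - (∑ j, w j) / n) ^ 2 = ∑ i, w i ^ 2 - (∑ j, w j) ^ 2 / n := by
  have hn' : (n : ℝ) ≠ 0 := by exact_mod_cast hn
  simp_rw [sub_sq, Finset.sum_add_distrib, Finset.sum_sub_distrib, ← Finset.sum_mul,
    ← Finset.mul_sum]
  simp
  field_simp
  ring

lemma sampleMean_eq {n : ℕ} (hn : n ≠ 0) (μ σ : ℝ) (w : Fin n → ℝ) :
    sampleMean (fun i => μ + σ * w i) = μ + σ * ((∑ i, w i) / n) := by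
  have hn' : (n : ℝ) ≠ 0 := by exact_mod_cast hn
  simp only [sampleMean, Finset.sum_add_distrib, ← Finset.mul_sum]
  simp
  field_simp

lemma ZStat_eq {n : ℕ} (hn : n ≠ 0) {T μ σ : ℝ} (hσ : σ ≠ 0) (w : Fin n → ℝ) :
    ZStat T σ (fun i => μ + σ * w i) = delta n T μ σ + (∑ i, w i) / √n := by
  have hn' : (0 : ℝ) < n := by exact_mod_cast hn.bot_lt
  have hs : √(n : ℝ) ≠ 0 := (Real.sqrt_pos.2 hn').ne'
  rw [ZStat, sampleMean_eq hn, delta]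
  have : (n : ℝ) = √n * √n := (Real.mul_self_sqrt hn'.le).symm
  rw [show (∑ i, w i) / (n : ℝ) = (∑ i, w i) / (√n * √n) by rw [← this]]
  field_simp
  ring

lemma KStat_eq {n : ℕ} (hn : n ≠ 0) {μ σ : ℝ} (hσ : σ ≠ 0) (w : Fin n → ℝ) :
    KStat σ (fun i => μ + σ * w i) = ∑ i, w i ^ 2 - (∑ i, w i) ^ 2 / n := by
  have hn' : (n : ℝ) ≠ 0 := by exact_mod_cast hn
  rw [KStat, sampleVar, sampleMean_eq hn, ← sum_sq_sub_mean hn]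
  have (i : Fin n) : (μ + σ * w i - (μ + σ * ((∑ i, w i) / n))) ^ 2 =
      σ ^ 2 * (w i - (∑ i, w i) / n) ^ 2 := by ring
  simp_rw [this, ← Finset.mul_sum]
  field_simp

/-- Joint law of the normalized mean and variance of a normal sample. -/
lemma hasLaw_ZStat_KStat {Ω : Type*} [MeasurableSpace Ω] {P : Measure Ω}
    {n : ℕ} (hn : 2 ≤ n) {T μ σ : ℝ} (hσ : 0 < σ) {X : Fin n → Ω → ℝ}
    (hX : ∀ i, HasLaw (X i) (gaussianReal μ (Real.toNNReal (σ ^ 2))) P)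
    (hindep : iIndepFun X P) :
    HasLaw (fun ω => ZStat T σ fun i => X i ω) (gaussianReal (delta n T μ σ) 1) P ∧
    HasLaw (fun ω => KStat σ fun i => X i ω) (gammaMeasure (((n : ℝ) - 1) / 2) (1 / 2)) P ∧
    IndepFun (fun ω => KStat σ fun i => X i ω) (fun ω => ZStat T σ fun i => X i ω) P := by
  have hn0 : n ≠ 0 := by omega
  have hPr : IsProbabilityMeasure P := hindep.isProbabilityMeasure
  let N : Fin n → Ω → ℝ := fun i ω => (X i ω - μ) / σ
  have hN (i : Fin n) : HasLaw (N i) (gaussianReal 0 1) P := by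
    have h := gaussianReal_div_const (gaussianReal_sub_const (hX i) μ) σ
    have h1 : Real.toNNReal (σ ^ 2) / NNReal.mk (σ ^ 2) (sq_nonneg _) = 1 := by
      have : Real.toNNReal (σ ^ 2) = NNReal.mk (σ ^ 2) (sq_nonneg _) :=
        Real.toNNReal_of_nonneg (sq_nonneg _)
      rw [this]
      refine div_self fun h0 => ?_
      have := congrArg NNReal.toReal h0
      simp [hσ.ne'] at this
    rwa [h1, sub_self, zero_div] at h
  have hNind : iIndepFun N P :=
    hindep.comp (fun _ x => (x - μ) / σ) fun _ => by fun_prop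
  have hXN (ω : Ω) : (fun i => X i ω) = fun i => μ + σ * N i ω := by
    funext i
    simp only [N]
    field_simp
    ring
  let i₀ : Fin n := ⟨0, by omega⟩
  obtain ⟨b, hb⟩ := exists_orthonormalBasis_const i₀
  set G : Fin n → Ω → ℝ := fun i ω => b.repr (WithLp.toLp 2 fun j => N j ω) i with hG
  obtain ⟨hGl, hGi⟩ : (∀ i, HasLaw (G i) (gaussianReal 0 1) P) ∧ iIndepFun G P :=
    iIndepFun_repr_of_gaussianReal hN hNind b
  have hG0 (ω : Ω) : G i₀ ω = (∑ i, N i ω) / √n := by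
    simp only [hG, b.repr_apply_apply, PiLp.inner_apply, hb]
    simp [div_eq_mul_inv, Finset.sum_mul]
  have hZ : (fun ω => ZStat T σ fun i => X i ω) = fun ω => delta n T μ σ + G i₀ ω := by
    funext ω
    rw [hXN, ZStat_eq hn0 hσ.ne', hG0]
  -- Parseval: `K` is the full squared norm minus the square of coordinate `i₀`, which accounts for
  -- the lost degree of freedom.
  have hK : (fun ω => KStat σ fun i => X i ω) = fun ω => ∑ i ∈ {i₀}ᶜ, G i ω ^ 2 := by
    funext ω
    rw [hXN, KStat_eq hn0 hσ.ne', ← sum_sq_repr b, ← Finset.sum_add_sum_compl {i₀},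
      Finset.sum_singleton]
    change G i₀ ω ^ 2 + ∑ i ∈ {i₀}ᶜ, G i ω ^ 2 - _ = _
    rw [hG0, div_pow, Real.sq_sqrt (Nat.cast_nonneg n)]
    ring
  refine ⟨?_, ?_, ?_⟩
  · rw [hZ]
    simpa using gaussianReal_const_add (hGl i₀) (delta n T μ σ)
  · have hcard : (({i₀}ᶜ : Finset (Fin n)).card : ℝ) = n - 1 := by
      rw [Finset.card_compl, Finset.card_singleton, Fintype.card_fin, Nat.cast_sub (by omega)]
      simp
    have hne : ({i₀}ᶜ : Finset (Fin n)).Nonempty := by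
      rw [← Finset.card_pos, Finset.card_compl, Finset.card_singleton, Fintype.card_fin]
      omega
    have h := hasLaw_sum_gammaMeasure (by norm_num) (by norm_num)
      (fun i => hasLaw_sq_of_gaussianReal (hGl i))
      (hGi.comp (fun _ x => x ^ 2) fun _ => by fun_prop) hne
    rw [hcard, mul_one_div] at h
    rw [hK]
    convert h using 1
    funext ω
    simp
  -- `K` and `Z` depend on disjoint sets of independent coordinates.
  · have h := hGi.indepFun_finset₀ {i₀}ᶜ {i₀} (by simp) fun i => (hGl i).aemeasurable
    have h2 := h.comp
      (φ := fun g : ({i₀}ᶜ : Finset (Fin n)) → ℝ => ∑ i, g i ^ 2)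
      (ψ := fun g : ({i₀} : Finset (Fin n)) → ℝ =>
        delta n T μ σ + g ⟨i₀, Finset.mem_singleton_self i₀⟩)
      (by fun_prop) (by fun_prop)
    rw [hZ, hK]
    convert h2 using 1
    · funext ω
      exact (Finset.sum_coe_sort {i₀}ᶜ fun i => G i ω ^ 2).symm
    · rfl

/-! ### Change of variables and the law of the ratio -/

lemma image_sq_div_sub {w c : ℝ} (hw : w ≠ 0) :
    (fun x => (w / (3 * x)) ^ 2 - c) '' {x | 0 < w * x} = Ioi (-c) := by
  ext k
  simp only [mem_image, mem_ofPred_eq, mem_Ioi]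
  constructor
  · rintro ⟨x, hx, rfl⟩
    have hx0 : x ≠ 0 := right_ne_zero_of_mul hx.ne'
    have : 0 < (w / (3 * x)) ^ 2 := by positivity
    linarith
  · intro hk
    have hk' : 0 < k + c := by linarith
    have hs : 0 < √(k + c) := Real.sqrt_pos.2 hk'
    refine ⟨w / (3 * √(k + c)), ?_, ?_⟩
    · rw [← mul_div_assoc]
      have := mul_self_pos.2 hw
      positivity
    · have : w / (3 * (w / (3 * √(k + c)))) = √(k + c) := by field_simp
      rw [this, Real.sq_sqrt hk'.le]
      ring

lemma div_sqrt_sq_div {w x : ℝ} (h : 0 < w * x) : w / (3 * √((w / (3 * x)) ^ 2)) = x := by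
  have hx0 : x ≠ 0 := right_ne_zero_of_mul h.ne'
  have hw0 : w ≠ 0 := left_ne_zero_of_mul h.ne'
  have : 0 < w / (3 * x) := by
    have h1 : w / (3 * x) = w * x / (3 * x ^ 2) := by field_simp
    rw [h1]
    exact div_pos h (by positivity)
  rw [Real.sqrt_sq this.le]
  field_simp

lemma measurableSet_mul_pos (w : ℝ) : MeasurableSet {x : ℝ | 0 < w * x} :=
  measurableSet_lt measurable_const (measurable_const_mul w)

/-- Change of variables from `k` to `x = w / (3 √(k + c))`. -/
lemma lintegral_comp_div_sqrt {f : ℝ → ℝ} (hf : ∀ k < 0, f k = 0) {c w : ℝ} (hc : 0 ≤ c)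
    (hw : w ≠ 0) (g : ℝ → ℝ≥0∞) :
    ∫⁻ k, ENNReal.ofReal (f k) * g (w / (3 * √(k + c))) =
      ∫⁻ x in {x | 0 < w * x}, ENNReal.ofReal (2 / |x| * (w / (3 * x)) ^ 2) *
        (ENNReal.ofReal (f ((w / (3 * x)) ^ 2 - c)) * g x) := by
  have hderiv : ∀ x ∈ {x | 0 < w * x}, HasDerivWithinAt (fun x => (w / (3 * x)) ^ 2 - c)
      (-(2 / x) * (w / (3 * x)) ^ 2) {x | 0 < w * x} x := by
    intro x (hx : 0 < w * x)
    have hx0 : x ≠ 0 := right_ne_zero_of_mul hx.ne'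
    have h1 : HasDerivAt (fun x : ℝ => 3 * x) 3 x := by
      simpa using (hasDerivAt_id x).const_mul (3 : ℝ)
    have h2 := ((((hasDerivAt_const x w).fun_div h1 (by positivity)).fun_pow 2).sub_const
      c).hasDerivWithinAt (s := {x | 0 < w * x})
    refine h2.congr_deriv ?_
    simp only [Nat.cast_ofNat, Nat.add_one_sub_one, pow_one, zero_mul, zero_sub]
    field_simp
  have hinj : InjOn (fun x => (w / (3 * x)) ^ 2 - c) {x | 0 < w * x} := by
    intro x (hx : 0 < w * x) z (hz : 0 < w * z) h
    simp only [sub_left_inj] at h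
    rw [← div_sqrt_sq_div hx, h, div_sqrt_sq_div hz]
  have himage := lintegral_image_eq_lintegral_abs_deriv_mul (measurableSet_mul_pos w) hderiv hinj
    fun k => ENNReal.ofReal (f k) * g (w / (3 * √(k + c)))
  rw [image_sq_div_sub hw] at himage
  -- The image of the substitution is only `(-c, ∞)`; as `c ≥ 0`, `f` vanishes below it.
  have hzero : ∫⁻ k in Iio (-c), ENNReal.ofReal (f k) * g (w / (3 * √(k + c))) = 0 := by
    rw [setLIntegral_congr_fun (g := fun _ => 0) measurableSet_Iio, lintegral_zero]
    intro k (hk : k < -c)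
    simp [hf k (by linarith)]
  rw [← lintegral_add_compl _ (measurableSet_Ioi (a := -c)), compl_Ioi,
    ← setLIntegral_congr (Iio_ae_eq_Iic (a := -c)), hzero, add_zero, himage]
  refine setLIntegral_congr_fun (measurableSet_mul_pos w) fun x (hx : 0 < w * x) => ?_
  rw [sub_add_cancel, div_sqrt_sq_div hx, abs_mul, abs_neg, abs_div, abs_two, abs_sq]

/-- The integrand of the density of `(D - h √Y) / (3 √(K + v Y))`, where `K` and `Y` are
independent with densities `f` and `g`. -/
noncomputable def ratioKernel (f g : ℝ → ℝ) (D h v x y : ℝ) : ℝ :=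
  f (((D - h * √y) / (3 * x)) ^ 2 - v * y) * g y * (2 / x) * ((D - h * √y) / (3 * x)) ^ 2

lemma measurable_ratioKernel {f g : ℝ → ℝ} (hf : Measurable f) (hg : Measurable g) (D h v : ℝ) :
    Measurable fun p : ℝ × ℝ => ratioKernel f g D h v p.1 p.2 := by
  unfold ratioKernel
  fun_prop

/-- The density of `(D - h √Y) / (3 √(K + v Y))`, with values in `[0, ∞]`. -/
noncomputable def ratioDensity (f g : ℝ → ℝ) (D h v x : ℝ) : ℝ≥0∞ :=
  ∫⁻ y in {y | 0 < (D - h * √y) * x}, ENNReal.ofReal |ratioKernel f g D h v x y|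

lemma measurableSet_ratio (D h : ℝ) :
    MeasurableSet {p : ℝ × ℝ | 0 < (D - h * √p.2) * p.1} :=
  measurableSet_lt measurable_const (by fun_prop)

lemma measurableSet_ratio_section (D h x : ℝ) : MeasurableSet {y : ℝ | 0 < (D - h * √y) * x} :=
  measurableSet_lt measurable_const (by fun_prop)

lemma ratioDensity_eq_lintegral_indicator (f g : ℝ → ℝ) (D h v x : ℝ) :
    ratioDensity f g D h v x = ∫⁻ y, {p : ℝ × ℝ | 0 < (D - h * √p.2) * p.1}.indicator
      (fun p => ENNReal.ofReal |ratioKernel f g D h v p.1 p.2|) (x, y) := by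
  rw [ratioDensity, ← lintegral_indicator (measurableSet_ratio_section D h x)]
  rfl

lemma measurable_ratioDensity {f g : ℝ → ℝ} (hf : Measurable f) (hg : Measurable g) (D h v : ℝ) :
    Measurable (ratioDensity f g D h v) := by
  simp_rw [funext (ratioDensity_eq_lintegral_indicator f g D h v)]
  exact (Measurable.indicator (measurable_ratioKernel hf hg D h v).abs.ennreal_ofReal
    (measurableSet_ratio D h)).lintegral_prod_right'

/-- The substitution in `k` degenerates only where the numerator vanishes, which can happen only at
`y = (D / h)²`. -/
lemma ae_sub_mul_sqrt_ne_zero {D : ℝ} (hD : D ≠ 0) (h : ℝ) : ∀ᵐ y : ℝ, D - h * √y ≠ 0 := by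
  have : ∀ᵐ y : ℝ, y ≠ (D / h) ^ 2 := by simp [ae_iff]
  refine this.mono fun y hy h0 => hy ?_
  have hh : h ≠ 0 := by
    rintro rfl
    simp [hD] at h0
  have hs : √y = D / h := by
    field_simp
    linarith
  have hy0 : 0 ≤ y := by
    by_contra! hneg
    rw [Real.sqrt_eq_zero_of_nonpos hneg.le] at h0
    simp [hD] at h0
  rw [← hs, Real.sq_sqrt hy0]

/-- Test against a nonnegative measurable function, substitute in `k` with `y` frozen, then exchange
the integrals. Working in `[0, ∞]` requires no integrability at this stage. -/
lemma hasLaw_ratio {Ω : Type*} [MeasurableSpace Ω] {P : Measure Ω} [IsProbabilityMeasure P]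
    {K Y : Ω → ℝ} {f g : ℝ → ℝ} (hf : Measurable f) (hg : Measurable g)
    (hf0 : ∀ k, 0 ≤ f k) (hg0 : ∀ y, 0 ≤ g y)
    (hfneg : ∀ k < 0, f k = 0) (hgneg : ∀ y < 0, g y = 0)
    (hK : HasLaw K (volume.withDensity fun k => ENNReal.ofReal (f k)) P)
    (hY : HasLaw Y (volume.withDensity fun y => ENNReal.ofReal (g y)) P)
    (hKY : IndepFun K Y P) {D h v : ℝ} (hD : D ≠ 0) (hv : 0 ≤ v) :
    HasLaw (fun ω => (D - h * √(Y ω)) / (3 * √(K ω + v * Y ω)))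
      (volume.withDensity (ratioDensity f g D h v)) P := by
  have hjoint := (indepFun_iff_hasLaw_prodMk_prod hY hK).1 hKY.symm
  have hm : Measurable fun p : ℝ × ℝ => (D - h * √p.1) / (3 * √(p.2 + v * p.1)) := by fun_prop
  refine HasLaw.fun_comp (Y := fun p : ℝ × ℝ => (D - h * √p.1) / (3 * √(p.2 + v * p.1)))
    ⟨hm.aemeasurable, ?_⟩ hjoint
  refine Measure.ext_of_lintegral _ fun φ hφ => ?_
  have hφm : Measurable fun p : ℝ × ℝ => φ ((D - h * √p.1) / (3 * √(p.2 + v * p.1))) :=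
    hφ.comp hm
  rw [lintegral_map hφ hm, lintegral_prod _ hφm.aemeasurable,
    lintegral_withDensity_eq_lintegral_mul _ hg.ennreal_ofReal hφm.lintegral_prod_right',
    lintegral_withDensity_eq_lintegral_mul _ (measurable_ratioDensity hf hg D h v) hφ]
  simp only [Pi.mul_apply]
  set S : Set (ℝ × ℝ) := {p | 0 < (D - h * √p.2) * p.1}
  have hR : Measurable (S.indicator fun p : ℝ × ℝ =>
      ENNReal.ofReal |ratioKernel f g D h v p.1 p.2|) :=
    Measurable.indicator (measurable_ratioKernel hf hg D h v).abs.ennreal_ofReal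
      (measurableSet_ratio D h)
  calc _ = ∫⁻ y, ∫⁻ x, S.indicator (fun p : ℝ × ℝ =>
        ENNReal.ofReal |ratioKernel f g D h v p.1 p.2|) (x, y) * φ x := by
        refine lintegral_congr_ae ((ae_sub_mul_sqrt_ne_zero hD h).mono fun y hw => ?_)
        simp only
        rcases lt_or_ge y 0 with hy | hy
        · have hzero (x : ℝ) : S.indicator (fun p : ℝ × ℝ =>
              ENNReal.ofReal |ratioKernel f g D h v p.1 p.2|) (x, y) = 0 := by
            by_cases hx : (x, y) ∈ S <;> simp [hx, ratioKernel, hgneg y hy]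
          simp [hzero, hgneg y hy]
        · have hφy : Measurable fun k => φ ((D - h * √y) / (3 * √(k + v * y))) :=
            hφm.comp measurable_prodMk_left
          rw [lintegral_withDensity_eq_lintegral_mul _ hf.ennreal_ofReal hφy]
          simp only [Pi.mul_apply]
          rw [lintegral_comp_div_sqrt hfneg (mul_nonneg hv hy) hw,
            ← lintegral_const_mul' _ _ ENNReal.ofReal_ne_top,
            ← lintegral_indicator (measurableSet_mul_pos _)]
          refine lintegral_congr fun x => ?_
          by_cases hx : 0 < (D - h * √y) * x
          · have hx' : (x, y) ∈ S := hx
            rw [indicator_of_mem hx', indicator_of_mem (by exact hx), ← mul_assoc, ← mul_assoc,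
              ← ENNReal.ofReal_mul (hg0 y),
              ← ENNReal.ofReal_mul (mul_nonneg (hg0 y) (by positivity))]
            congr 2
            simp only [ratioKernel]
            rw [abs_mul, abs_mul, abs_mul, abs_of_nonneg (hf0 _), abs_of_nonneg (hg0 _), abs_div,
              abs_two, abs_sq]
            ring
          · have hx' : (x, y) ∉ S := hx
            rw [indicator_of_notMem hx', indicator_of_notMem (by exact hx), zero_mul]
    _ = ∫⁻ x, ∫⁻ y, S.indicator (fun p : ℝ × ℝ =>
        ENNReal.ofReal |ratioKernel f g D h v p.1 p.2|) (x, y) * φ x :=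
        (lintegral_lintegral_swap (f := fun x y => S.indicator (fun p : ℝ × ℝ =>
          ENNReal.ofReal |ratioKernel f g D h v p.1 p.2|) (x, y) * φ x)
          (hR.mul (hφ.comp measurable_fst)).aemeasurable).symm
    _ = _ := by
        refine lintegral_congr fun x => ?_
        have hRx : Measurable fun y => S.indicator (fun p : ℝ × ℝ =>
            ENNReal.ofReal |ratioKernel f g D h v p.1 p.2|) (x, y) :=
          hR.comp measurable_prodMk_left
        rw [lintegral_mul_const _ hRx, ratioDensity_eq_lintegral_indicator]

/-! ### Integrability of the kernel -/

lemma integrable_exp_neg_mul_abs_div_sqrt {b : ℝ} (hb : 0 < b) :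
    Integrable fun t : ℝ => Real.exp (-b * |t|) / √|t| := by
  have h := integrableOn_rpow_mul_exp_neg_mul_rpow (s := -(1 / 2)) (p := 1) (by norm_num)
    one_pos hb
  have h1 : IntegrableOn (fun t : ℝ => Real.exp (-b * |t|) / √|t|) (Ioi 0) := by
    refine h.congr_fun (fun t (ht : 0 < t) => ?_) measurableSet_Ioi
    simp only
    rw [abs_of_pos ht, Real.rpow_one, Real.rpow_neg ht.le, ← Real.sqrt_eq_rpow,
      div_eq_inv_mul]
  have h2 : IntegrableOn (fun t : ℝ => Real.exp (-b * |t|) / √|t|) (Iio 0) := by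
    have := IntegrableOn.comp_neg_Iio (c := (0 : ℝ)) (by simpa using h1)
    simpa using this
  have h3 := (h1.union h2)
  rw [← integrableOn_univ]
  refine h3.congr_set_ae ?_
  have hne : ∀ᵐ t : ℝ, t ≠ 0 := by simp [ae_iff]
  refine (hne.mono fun t ht => ?_)
  refine propext ⟨fun _ => ?_, fun _ => trivial⟩
  rcases lt_or_gt_of_ne ht with ht | ht
  · exact Or.inr ht
  · exact Or.inl ht

lemma one_le_sqrt_add_sqrt_one_sub {t : ℝ} (h0 : 0 ≤ t) (h1 : t ≤ 1) : 1 ≤ √t + √(1 - t) := by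
  have h2 : t ≤ √t := Real.le_sqrt_of_sq_le (by nlinarith)
  have h3 : 1 - t ≤ √(1 - t) := Real.le_sqrt_of_sq_le (by nlinarith)
  linarith

/-- The singularities at 0 and 1 are separated. Below 1, `1 ≤ √t + √(1 - t)` gives a partial
fraction; above 1, `√t ≥ 1` can be dropped. -/
lemma exp_div_sqrt_mul_sqrt_le {b t : ℝ} (hb : 0 < b) (ht : 0 < t) (ht1 : t ≠ 1) :
    Real.exp (-b * t) / (√t * √|1 - t|) ≤
      Real.exp b * (Real.exp (-b * |t|) / √|t| + Real.exp (-b * |1 - t|) / √|1 - t|) := by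
  have hs : 0 < √t := Real.sqrt_pos.2 ht
  have hs1 : 0 < √|1 - t| := Real.sqrt_pos.2 (abs_pos.2 (sub_ne_zero.2 ht1.symm))
  rw [abs_of_pos ht]
  rcases lt_or_gt_of_ne ht1 with h | h
  · have h1t : 0 < 1 - t := sub_pos.2 h
    rw [abs_of_pos h1t] at hs1 ⊢
    have e1 : Real.exp (-b * t) ≤ 1 := Real.exp_le_one_iff.2 (by nlinarith)
    have e2 : 1 ≤ Real.exp b * Real.exp (-b * t) := by
      rw [← Real.exp_add]; exact Real.one_le_exp (by nlinarith)
    have e3 : 1 ≤ Real.exp b * Real.exp (-b * (1 - t)) := by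
      rw [← Real.exp_add]; exact Real.one_le_exp (by nlinarith)
    calc Real.exp (-b * t) / (√t * √(1 - t)) ≤ (√t + √(1 - t)) / (√t * √(1 - t)) := by
          gcongr
          exact e1.trans (one_le_sqrt_add_sqrt_one_sub ht.le h.le)
      _ = 1 / √t + 1 / √(1 - t) := by field_simp; ring
      _ ≤ Real.exp b * Real.exp (-b * t) / √t + Real.exp b * Real.exp (-b * (1 - t)) / √(1 - t) := by
          gcongr
      _ = _ := by ring
  · have h1t : 1 - t < 0 := sub_neg.2 h
    rw [abs_of_neg h1t] at hs1 ⊢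
    have e1 : 1 ≤ √t := Real.one_le_sqrt.2 h.le
    calc Real.exp (-b * t) / (√t * √(-(1 - t))) ≤ Real.exp (-b * t) / (1 * √(-(1 - t))) := by
          gcongr
      _ ≤ Real.exp (b + -b * -(1 - t)) / √(-(1 - t)) := by
          rw [one_mul]
          gcongr
          nlinarith
      _ = Real.exp b * (0 + Real.exp (-b * -(1 - t)) / √(-(1 - t))) := by
          rw [Real.exp_add]; ring
      _ ≤ _ := by gcongr; positivity

/-- From `(r - 2)² ≥ 0`, `(1 - r)² ≥ r²/2 - 1`, which leaves the decay `exp(-a r²/2)`; half of it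
absorbs the polynomial factor. -/
lemma one_add_sq_mul_exp_le {a r : ℝ} (ha : 0 < a) :
    (1 + r) ^ 2 * Real.exp (-a * (1 - r) ^ 2) ≤
      2 * (1 + 4 / a) * Real.exp a * Real.exp (-(a / 4) * r ^ 2) := by
  have h1 : (1 + r) ^ 2 ≤ 2 * (1 + 4 / a) * Real.exp (a / 4 * r ^ 2) := by
    have h2 : 1 + a / 4 * r ^ 2 ≤ Real.exp (a / 4 * r ^ 2) := by
      rw [add_comm]; exact Real.add_one_le_exp _
    calc (1 + r) ^ 2 ≤ 2 * (1 + r ^ 2) := by nlinarith [sq_nonneg (1 - r)]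
      _ ≤ 2 * ((1 + 4 / a) * (1 + a / 4 * r ^ 2)) := by
          have : (1 + 4 / a) * (1 + a / 4 * r ^ 2) = 1 + r ^ 2 + (4 / a + a / 4 * r ^ 2) := by
            field_simp; ring
          rw [this]
          have : 0 ≤ 4 / a + a / 4 * r ^ 2 := by positivity
          linarith
      _ ≤ 2 * ((1 + 4 / a) * Real.exp (a / 4 * r ^ 2)) := by gcongr
      _ = _ := by ring
  have h3 : Real.exp (-a * (1 - r) ^ 2) ≤ Real.exp (a - a / 2 * r ^ 2) := by
    gcongr
    nlinarith [mul_nonneg ha.le (sq_nonneg (r - 2))]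
  calc _ ≤ 2 * (1 + 4 / a) * Real.exp (a / 4 * r ^ 2) * Real.exp (a - a / 2 * r ^ 2) := by
        gcongr
    _ = 2 * (1 + 4 / a) * (Real.exp (a / 4 * r ^ 2) * Real.exp (a - a / 2 * r ^ 2)) := by ring
    _ = 2 * (1 + 4 / a) * (Real.exp a * Real.exp (-(a / 4) * r ^ 2)) := by
        rw [← Real.exp_add, ← Real.exp_add]; ring_nf
    _ = _ := by ring

/-- A difference of squares. The zero of the first factor, `s = D / (h + 3x√v)`, is the origin of
`K(x)`. -/
lemma sq_sub_eq_mul {D h v x s : ℝ} (hv : 0 ≤ v) (hx : x ≠ 0) :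
    ((D - h * s) / (3 * x)) ^ 2 - v * s ^ 2 =
      (D - (h + 3 * x * √v) * s) / (3 * x) * ((D - h * s) / (3 * x) + √v * s) := by
  have h1 : (D - (h + 3 * x * √v) * s) / (3 * x) = (D - h * s) / (3 * x) - √v * s := by
    field_simp
    ring
  rw [h1]
  nlinarith [Real.sq_sqrt hv]

/-- The set of those `t > 0` for which `1 - √t` has the sign of `x`. -/
def ratioRange (x : ℝ) : Set ℝ := {t | 0 < t ∧ 0 < (1 - √t) * x}

lemma ratioRange_of_pos {x : ℝ} (hx : 0 < x) : ratioRange x = Ioo 0 1 := by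
  ext t
  refine and_congr_right fun ht => ?_
  rw [mul_pos_iff_of_pos_right hx, sub_pos, Real.sqrt_lt' one_pos, one_pow]

lemma ratioRange_of_neg {x : ℝ} (hx : x < 0) : ratioRange x = Ioi 1 := by
  ext t
  simp only [ratioRange, mem_ofPred_eq, mem_Ioi]
  rw [mul_pos_iff]
  simp only [hx, hx.not_gt, and_false, and_true, false_or, sub_neg, Real.lt_sqrt zero_le_one,
    one_pow, and_iff_right_iff_imp]
  exact fun h => one_pos.trans h

lemma measurableSet_ratioRange (x : ℝ) : MeasurableSet (ratioRange x) :=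
  measurableSet_Ioi.inter (measurableSet_lt (f := fun _ : ℝ => (0 : ℝ))
    (g := fun t => (1 - √t) * x) measurable_const (by fun_prop))

lemma div_mul_three_pos_iff {w x : ℝ} (hx : x ≠ 0) : 0 < w / (3 * x) ↔ 0 < w * x := by
  have h1 : w / (3 * x) = w * x / (3 * x ^ 2) := by field_simp
  rw [h1, div_pos_iff_of_pos_right (by positivity)]

lemma norm_ratioKernel_le {f g : ℝ → ℝ} (hf0 : ∀ k, 0 ≤ f k) (hg0 : ∀ y, 0 ≤ g y) {Cf Cg : ℝ}
    (hf : ∀ k, 0 < k → f k ≤ Cf * Real.exp (-k / 4) / √k) (hg : ∀ y, 0 < y → g y ≤ Cg / √y)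
    {D h v x : ℝ} (hD : 0 < D) (hh : 0 ≤ h) (hv : 0 ≤ v) (hx : x ≠ 0)
    (he : 0 < h + 3 * x * √v) :
    ∃ M b : ℝ, 0 < b ∧ ∀ t ∈ ratioRange x,
      ‖ratioKernel f g D h v x (t * (D / (h + 3 * x * √v)) ^ 2)‖ ≤
        M * (Real.exp (-b * t) / (√t * √|1 - t|)) := by
  set e := h + 3 * x * √v
  set κ := D / e
  have hκ : 0 < κ := div_pos hD he
  have heκ : e * κ = D := mul_div_cancel₀ _ he.ne'
  have hCf : 0 ≤ Cf := by
    have := (hf0 1).trans (hf 1 one_pos)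
    rw [Real.sqrt_one, div_one] at this
    exact nonneg_of_mul_nonneg_left this (Real.exp_pos _)
  have hCg : 0 ≤ Cg := by simpa using (hg0 1).trans (hg 1 one_pos)
  -- Below, with `r = √t`, the two factors of the argument of `f` are controlled by `q = A|1 - r|`
  -- and `W ≤ B(1 + r)`.
  set A := D / (3 * |x|)
  set B := (D + h * κ) / (3 * |x|)
  have hx' : 0 < |x| := abs_pos.2 hx
  have hA : 0 < A := by positivity
  have hB : 0 < B := by positivity
  refine ⟨Cf * √(B ^ 3 / A) * (Cg / κ) * (2 / |x|) *
    (2 * (1 + 4 / (A ^ 2 / 4)) * Real.exp (A ^ 2 / 4)), A ^ 2 / 4 / 4, by positivity, ?_⟩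
  rintro t ⟨ht, htx⟩
  set r := √t with hr
  have hr0 : 0 < r := Real.sqrt_pos.2 ht
  have hrt : r ^ 2 = t := Real.sq_sqrt ht.le
  have hs : √(t * κ ^ 2) = r * κ := by rw [Real.sqrt_mul ht.le, Real.sqrt_sq hκ.le]
  set W := (D - h * (r * κ)) / (3 * x) with hW
  have hq : (D - e * (r * κ)) / (3 * x) = D * (1 - r) / (3 * x) := by
    rw [← heκ]; ring
  set q := D * (1 - r) / (3 * x) with hq'
  have hq0 : 0 < q := by
    rw [hq', div_mul_three_pos_iff hx, mul_assoc]
    exact mul_pos hD htx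
  have hWq : W = q + √v * (r * κ) := by
    rw [← hq, hW]
    simp only [e]
    field_simp
    ring
  have hvr : 0 ≤ √v * (r * κ) := by positivity
  have hW0 : 0 < W := by linarith
  have hqA : q = A * |1 - r| := by
    rw [← abs_of_pos hq0, hq', abs_div, abs_mul, abs_mul, abs_of_pos hD,
      abs_of_pos (three_pos (α := ℝ))]
    simp only [A]
    ring
  have h1r : 0 < |1 - r| := by
    rw [hqA] at hq0
    exact pos_of_mul_pos_right hq0 hA.le
  have hWB : W ≤ B * (1 + r) := by
    rw [← abs_of_pos hW0, hW, abs_div, abs_mul, abs_of_pos (three_pos (α := ℝ))]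
    simp only [B]
    rw [div_mul_eq_mul_div]
    gcongr
    have hhr : 0 ≤ h * (r * κ) := by positivity
    have hhk : 0 ≤ h * κ := by positivity
    rw [abs_le]
    constructor <;> nlinarith [mul_pos hD hr0]
  have harg : ((D - h * √(t * κ ^ 2)) / (3 * x)) ^ 2 - v * (t * κ ^ 2) =
      q * (W + √v * (r * κ)) := by
    have := sq_sub_eq_mul (D := D) (h := h) (s := r * κ) hv hx
    rw [hq] at this
    rw [hs, ← this, mul_pow, hrt]
  have hargW : q * W ≤ q * (W + √v * (r * κ)) := by gcongr; linarith
  have hargq : q ^ 2 ≤ q * (W + √v * (r * κ)) := by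
    rw [sq]; gcongr; linarith
  set k := q * (W + √v * (r * κ))
  have hk0 : 0 < k := lt_of_lt_of_le (mul_pos hq0 hW0) hargW
  have h1t : |1 - t| = |1 - r| * (1 + r) := by
    have h2 : |1 + r| = 1 + r := abs_of_pos (by positivity)
    rw [← hrt, ← h2, ← abs_mul]
    ring_nf
  have h1t0 : 0 < |1 - t| := by rw [h1t]; positivity
  -- The bound `k ≥ qW` moves the singularity of `f` to `t = 1`, since `|1 - t| = |1 - r|(1 + r)`;
  -- the other bound, `k ≥ q²`, supplies the exponential decay.
  have hmain : W ^ 2 / √k ≤ √(B ^ 3 / A) * ((1 + r) ^ 2 / √|1 - t|) := by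
    have e1 : W ^ 2 / √k = √(W ^ 4 / k) := by
      rw [Real.sqrt_div (by positivity), show W ^ 4 = (W ^ 2) ^ 2 by ring,
        Real.sqrt_sq (by positivity)]
    have e2 : √(B ^ 3 / A) * ((1 + r) ^ 2 / √|1 - t|) =
        √(B ^ 3 / A * ((1 + r) ^ 4 / |1 - t|)) := by
      rw [Real.sqrt_mul (by positivity), Real.sqrt_div (by positivity : 0 ≤ (1 + r) ^ 4),
        show (1 + r) ^ 4 = ((1 + r) ^ 2) ^ 2 by ring, Real.sqrt_sq (by positivity)]
    rw [e1, e2]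
    refine Real.sqrt_le_sqrt ?_
    calc W ^ 4 / k ≤ W ^ 4 / (q * W) := by gcongr
      _ = W ^ 3 / q := by field_simp
      _ ≤ (B * (1 + r)) ^ 3 / q := by gcongr
      _ = _ := by rw [hqA, h1t]; field_simp
  have hexp : Real.exp (-k / 4) ≤ Real.exp (-(A ^ 2 / 4) * (1 - r) ^ 2) := by
    gcongr
    have : q ^ 2 = A ^ 2 * (1 - r) ^ 2 := by rw [hqA, mul_pow, sq_abs]
    linarith
  have hsy : √(t * κ ^ 2) = κ * r := by rw [hs, mul_comm]
  calc ‖ratioKernel f g D h v x (t * κ ^ 2)‖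
      = f k * g (t * κ ^ 2) * (2 / |x|) * W ^ 2 := by
        rw [ratioKernel, harg, hs, ← hW, Real.norm_eq_abs, abs_mul, abs_mul, abs_mul,
          abs_of_nonneg (hf0 _), abs_of_nonneg (hg0 _), abs_div, abs_two, abs_sq]
    _ ≤ (Cf * Real.exp (-k / 4) / √k) * (Cg / √(t * κ ^ 2)) * (2 / |x|) * W ^ 2 := by
        gcongr
        · exact hg0 _
        · exact hf k hk0
        · exact hg _ (by positivity)
    _ = Cf * Real.exp (-k / 4) * (Cg / κ / r) * (2 / |x|) * (W ^ 2 / √k) := by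
        rw [hsy]; field_simp
    _ ≤ Cf * Real.exp (-(A ^ 2 / 4) * (1 - r) ^ 2) * (Cg / κ / r) * (2 / |x|) *
        (√(B ^ 3 / A) * ((1 + r) ^ 2 / √|1 - t|)) := by gcongr
    _ = Cf * √(B ^ 3 / A) * (Cg / κ) * (2 / |x|) / (r * √|1 - t|) *
        ((1 + r) ^ 2 * Real.exp (-(A ^ 2 / 4) * (1 - r) ^ 2)) := by field_simp
    _ ≤ Cf * √(B ^ 3 / A) * (Cg / κ) * (2 / |x|) / (r * √|1 - t|) *
        (2 * (1 + 4 / (A ^ 2 / 4)) * Real.exp (A ^ 2 / 4) *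
          Real.exp (-(A ^ 2 / 4 / 4) * r ^ 2)) := by
        exact mul_le_mul_of_nonneg_left (one_add_sq_mul_exp_le (by positivity)) (by positivity)
    _ = _ := by rw [hrt]; ring

lemma integrableOn_ratioKernel {f g : ℝ → ℝ} (hfm : Measurable f) (hgm : Measurable g)
    (hf0 : ∀ k, 0 ≤ f k) (hg0 : ∀ y, 0 ≤ g y) {Cf Cg : ℝ}
    (hf : ∀ k, 0 < k → f k ≤ Cf * Real.exp (-k / 4) / √k) (hg : ∀ y, 0 < y → g y ≤ Cg / √y)
    {D h v x : ℝ} (hD : 0 < D) (hh : 0 ≤ h) (hv : 0 ≤ v) (hx : x ≠ 0)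
    (he : 0 < h + 3 * x * √v) :
    IntegrableOn (fun t => ratioKernel f g D h v x (t * (D / (h + 3 * x * √v)) ^ 2))
      (ratioRange x) := by
  obtain ⟨M, b, hb, hM⟩ := norm_ratioKernel_le hf0 hg0 hf hg hD hh hv hx he
  have hψ := integrable_exp_neg_mul_abs_div_sqrt hb
  have hdom := ((hψ.add (hψ.comp_sub_left 1)).const_mul (|M| * Real.exp b)).integrableOn
    (s := ratioRange x)
  refine hdom.mono' (Measurable.aestronglyMeasurable ?_) ?_
  · exact (measurable_ratioKernel hfm hgm D h v).comp (f := fun t : ℝ =>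
      (x, t * (D / (h + 3 * x * √v)) ^ 2)) (by fun_prop)
  · refine (ae_restrict_mem (measurableSet_ratioRange x)).mono fun t ht => ?_
    have ht1 : t ≠ 1 := by
      rintro rfl
      simpa using ht.2
    calc _ ≤ M * (Real.exp (-b * t) / (√t * √|1 - t|)) := hM t ht
      _ ≤ |M| * (Real.exp (-b * t) / (√t * √|1 - t|)) := by gcongr; exact le_abs_self M
      _ ≤ _ := by
        rw [mul_assoc]
        exact mul_le_mul_of_nonneg_left (exp_div_sqrt_mul_sqrt_le hb ht.1 ht1) (abs_nonneg M)

/-! ### Support of the kernel and rescaling by `K(x)` -/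

/-- The second factor in `sq_sub_eq_mul` is positive here, so the sign of the first makes the
argument of `f` negative. -/
lemma ratioKernel_eq_zero {f g : ℝ → ℝ} (hfneg : ∀ k < 0, f k = 0) {D h v x y : ℝ}
    (hv : 0 ≤ v) (hy : 0 < y) (hxy : 0 < (D - h * √y) * x)
    (hneg : (D - (h + 3 * x * √v) * √y) * x < 0) : ratioKernel f g D h v x y = 0 := by
  have hx : x ≠ 0 := right_ne_zero_of_mul hxy.ne'
  have hW := (div_mul_three_pos_iff hx).2 hxy
  have hq : (D - (h + 3 * x * √v) * √y) / (3 * x) < 0 := by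
    have := (div_mul_three_pos_iff (w := -(D - (h + 3 * x * √v) * √y)) hx).2 (by linarith)
    rw [neg_div] at this
    linarith
  have h1 := sq_sub_eq_mul (D := D) (h := h) (s := √y) hv hx
  rw [Real.sq_sqrt hy.le] at h1
  have h2 : 0 < (D - h * √y) / (3 * x) + √v * √y := by positivity
  rw [ratioKernel, h1, hfneg _ (mul_neg_of_neg_of_pos hq h2)]
  ring

/-- When `h + 3x√v ≤ 0`, `D - (h + 3x√v)√y` stays positive for every `y`, opposite in sign to `x`.
-/
lemma ratioDensity_eq_zero {f g : ℝ → ℝ} (hfneg : ∀ k < 0, f k = 0) (hgneg : ∀ y ≤ 0, g y = 0)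
    {D h v x : ℝ} (hD : 0 < D) (hv : 0 ≤ v) (hx : x < 0) (he : h + 3 * x * √v ≤ 0) :
    ratioDensity f g D h v x = 0 := by
  rw [ratioDensity, setLIntegral_congr_fun (g := fun _ => 0) (measurableSet_ratio_section D h x),
    lintegral_zero]
  intro y (hy : 0 < (D - h * √y) * x)
  simp only
  rcases le_or_gt y 0 with hy0 | hy0
  · simp [ratioKernel, hgneg y hy0]
  · rw [ratioKernel_eq_zero hfneg hv hy0 hy, abs_zero, ENNReal.ofReal_zero]
    have : (h + 3 * x * √v) * √y ≤ 0 := mul_nonpos_of_nonpos_of_nonneg he (Real.sqrt_nonneg y)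
    exact mul_neg_of_pos_of_neg (by linarith) hx

/-- Substituting `y = tκ²` with `κ = D / e` turns `D - e√y` into `D(1 - √t)`. The part of the
section outside the rescaled range contributes nothing, because there the argument of `f` is
negative. -/
lemma ratioDensity_eq_lintegral_ratioRange {f g : ℝ → ℝ} (hfneg : ∀ k < 0, f k = 0)
    (hgneg : ∀ y ≤ 0, g y = 0) {D h v x : ℝ} (hD : 0 < D) (hv : 0 ≤ v)
    (hx : x ≠ 0) (he : 0 < h + 3 * x * √v) :
    ratioDensity f g D h v x = ∫⁻ t in ratioRange x, ENNReal.ofReal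
      |(D / (h + 3 * x * √v)) ^ 2 *
        ratioKernel f g D h v x (t * (D / (h + 3 * x * √v)) ^ 2)| := by
  set e := h + 3 * x * √v with he'
  set κ := D / e
  have hκ : 0 < κ := div_pos hD he
  have heκ : e * κ = D := mul_div_cancel₀ _ he.ne'
  have hderiv : ∀ t ∈ ratioRange x,
      HasDerivWithinAt (fun t : ℝ => t * κ ^ 2) (κ ^ 2) (ratioRange x) t := fun t _ => by
    simpa using ((hasDerivAt_id t).mul_const (κ ^ 2)).hasDerivWithinAt (s := ratioRange x)
  have hinj : InjOn (fun t : ℝ => t * κ ^ 2) (ratioRange x) := fun t _ s _ hts =>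
    mul_right_cancel₀ (by positivity) hts
  have himage := lintegral_image_eq_lintegral_abs_deriv_mul (measurableSet_ratioRange x) hderiv hinj
    fun y => ENNReal.ofReal |ratioKernel f g D h v x y|
  have hpre : (fun t : ℝ => t * κ ^ 2) '' ratioRange x = {y | y / κ ^ 2 ∈ ratioRange x} := by
    ext y
    constructor
    · rintro ⟨t, ht, rfl⟩
      simpa [mul_div_cancel_right₀ t (by positivity : κ ^ 2 ≠ 0)] using ht
    · intro hy
      exact ⟨y / κ ^ 2, hy, div_mul_cancel₀ y (by positivity)⟩
  have hmeas : MeasurableSet {y | y / κ ^ 2 ∈ ratioRange x} :=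
    (measurable_id.div_const (κ ^ 2)) (measurableSet_ratioRange x)
  have hR : ∀ t, ENNReal.ofReal |κ ^ 2 * ratioKernel f g D h v x (t * κ ^ 2)| =
      ENNReal.ofReal |κ ^ 2| * ENNReal.ofReal |ratioKernel f g D h v x (t * κ ^ 2)| := fun t => by
    rw [abs_mul, ENNReal.ofReal_mul (abs_nonneg _)]
  simp_rw [hR]
  rw [← himage, hpre, ratioDensity, ← lintegral_indicator (measurableSet_ratio_section D h x),
    ← lintegral_indicator hmeas]
  -- At `y = κ²` the argument of `f` is 0, where `f` is not assumed to vanish; this single point is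
  -- discarded.
  have hne : ∀ᵐ y : ℝ, y ≠ κ ^ 2 := by simp [ae_iff]
  refine lintegral_congr_ae (hne.mono fun y hyK => ?_)
  rcases le_or_gt y 0 with hy0 | hy0
  · have h0 : ratioKernel f g D h v x y = 0 := by simp [ratioKernel, hgneg y hy0]
    simp [indicator, h0]
  · have hsy : √(y / κ ^ 2) = √y / κ := by
      rw [Real.sqrt_div hy0.le, Real.sqrt_sq hκ.le]
    have hfac : D - e * √y = D * (1 - √y / κ) := by
      rw [← heκ]; field_simp
    by_cases hr : y / κ ^ 2 ∈ ratioRange x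
    · have hmem : 0 < (D - h * √y) * x := by
        have h1 := hr.2
        rw [hsy] at h1
        have h2 : 0 < (D - e * √y) * x := by
          rw [hfac, mul_assoc]; exact mul_pos hD h1
        have h3 : (D - h * √y) * x = (D - e * √y) * x + 3 * x ^ 2 * √v * √y := by
          rw [he']; ring
        rw [h3]
        positivity
      rw [indicator_of_mem (show y ∈ {y | 0 < (D - h * √y) * x} from hmem),
        indicator_of_mem (show y ∈ {y | y / κ ^ 2 ∈ ratioRange x} from hr)]
    · rw [indicator_of_notMem (show y ∉ {y | y / κ ^ 2 ∈ ratioRange x} from hr)]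
      by_cases hmem : 0 < (D - h * √y) * x
      · rw [indicator_of_mem (show y ∈ {y | 0 < (D - h * √y) * x} from hmem),
          ratioKernel_eq_zero hfneg hv hy0 hmem, abs_zero, ENNReal.ofReal_zero]
        have h1 : (1 - √y / κ) * x ≤ 0 := by
          by_contra! hcon
          exact hr ⟨by positivity, by rwa [hsy]⟩
        have h2 : (1 - √y / κ) * x ≠ 0 := by
          refine mul_ne_zero (fun h0 => hyK ?_) hx
          have : √y = κ := by
            field_simp at h0
            linarith
          rw [← this, Real.sq_sqrt hy0.le]
        rw [← he', hfac, mul_assoc]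
        exact mul_neg_of_pos_of_neg hD (lt_of_le_of_ne h1 h2)
      · rw [indicator_of_notMem (show y ∉ {y | 0 < (D - h * √y) * x} from hmem)]

/-! ### From the extended density to the split integral -/

lemma splitIntegral_of_pos (a : EReal) (I : ℝ → ℝ → ℝ) {x : ℝ} (hx : 0 < x) :
    splitIntegral a I x = ∫ t in ratioRange x, I x t := by
  rw [splitIntegral, if_pos hx, ratioRange_of_pos hx]

lemma splitIntegral_of_neg {a : EReal} (I : ℝ → ℝ → ℝ) {x : ℝ} (hx : x < 0)
    (hax : a < (x : EReal)) : splitIntegral a I x = ∫ t in ratioRange x, -I x t := by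
  rw [splitIntegral, if_neg hx.not_gt, if_pos ⟨hax, hx⟩, ratioRange_of_neg hx, integral_neg]

lemma splitIntegral_eq_zero {a : EReal} (I : ℝ → ℝ → ℝ) {x : ℝ} (hx : x ≤ 0)
    (hax : x < 0 → ¬ a < (x : EReal)) : splitIntegral a I x = 0 := by
  rw [splitIntegral, if_neg hx.not_gt, if_neg fun h => hax h.2 h.1]

/-- A variable of the form `(D - h √Y) / (3 √(K + v Y))` has a density given by a split
integral. -/
lemma hasSplitIntegralDensity_ratio {Ω : Type*} [MeasurableSpace Ω] {P : Measure Ω}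
    {f g : ℝ → ℝ} (hfm : Measurable f) (hgm : Measurable g)
    (hf0 : ∀ k, 0 ≤ f k) (hg0 : ∀ y, 0 ≤ g y)
    (hfneg : ∀ k < 0, f k = 0) (hgneg : ∀ y ≤ 0, g y = 0) {Cf Cg : ℝ}
    (hf : ∀ k, 0 < k → f k ≤ Cf * Real.exp (-k / 4) / √k) (hg : ∀ y, 0 < y → g y ≤ Cg / √y)
    {D h v : ℝ} (hD : 0 < D) (hh : 0 ≤ h) (hv : 0 ≤ v) (hhv : 0 < h ∨ 0 < v) {W : Ω → ℝ}
    (hW : HasLaw W (volume.withDensity (ratioDensity f g D h v)) P) {a : EReal}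
    (ha : ∀ x : ℝ, x < 0 → (a < (x : EReal) ↔ 0 < h + 3 * x * √v)) {I : ℝ → ℝ → ℝ}
    (hI : ∀ x t : ℝ, x ≠ 0 → 0 < h + 3 * x * √v → 0 < t →
      I x t = (D / (h + 3 * x * √v)) ^ 2 *
        ratioKernel f g D h v x (t * (D / (h + 3 * x * √v)) ^ 2)) :
    HasSplitIntegralDensity P W a I := by
  have hpos (x : ℝ) (hx : 0 < x) : 0 < h + 3 * x * √v := by
    rcases hhv with h0 | h0
    · positivity
    · have := Real.sqrt_pos.2 h0
      positivity
  have hint (x : ℝ) (hx : x ≠ 0) (he : 0 < h + 3 * x * √v) :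
      IntegrableOn (I x) (ratioRange x) :=
    IntegrableOn.congr_fun
      ((integrableOn_ratioKernel hfm hgm hf0 hg0 hf hg hD hh hv hx he).const_mul _)
      (fun t ht => (hI x t hx he ht.1).symm) (measurableSet_ratioRange x)
  have hker (x y : ℝ) : 0 ≤ f (((D - h * √y) / (3 * x)) ^ 2 - v * y) * g y *
      ((D - h * √y) / (3 * x)) ^ 2 :=
    mul_nonneg (mul_nonneg (hf0 _) (hg0 _)) (sq_nonneg _)
  -- Every factor of `I x t` except `2 / x` is nonnegative, so the sign convention of the split
  -- integral produces an absolute value.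
  have hsplit (x : ℝ) (hx : x ≠ 0) (he : 0 < h + 3 * x * √v) :
      splitIntegral a I x = ∫ t in ratioRange x, |I x t| := by
    rcases lt_or_gt_of_ne hx with hx0 | hx0
    · rw [splitIntegral_of_neg I hx0 ((ha x hx0).2 he)]
      refine setIntegral_congr_fun (measurableSet_ratioRange x) fun t ht => ?_
      rw [abs_of_nonpos]
      rw [hI x t hx he ht.1, ratioKernel]
      have h2 : 2 / x ≤ 0 := div_nonpos_of_nonneg_of_nonpos two_pos.le hx0.le
      have h3 := mul_nonpos_of_nonneg_of_nonpos
        (hker x (t * (D / (h + 3 * x * √v)) ^ 2)) h2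
      refine mul_nonpos_of_nonneg_of_nonpos (sq_nonneg _) ?_
      convert h3 using 1
      ring
    · rw [splitIntegral_of_pos a I hx0]
      refine setIntegral_congr_fun (measurableSet_ratioRange x) fun t ht => ?_
      rw [abs_of_nonneg]
      rw [hI x t hx he ht.1, ratioKernel]
      have h2 : 0 ≤ 2 / x := by positivity
      have h3 := mul_nonneg (hker x (t * (D / (h + 3 * x * √v)) ^ 2)) h2
      refine mul_nonneg (sq_nonneg _) ?_
      convert h3 using 1
      ring
  have hzero (x : ℝ) (hx : ¬ (x ≠ 0 ∧ 0 < h + 3 * x * √v)) : splitIntegral a I x = 0 := by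
    refine splitIntegral_eq_zero I ?_ fun hx0 hax => hx ⟨hx0.ne, (ha x hx0).1 hax⟩
    by_contra! hx0
    exact hx ⟨hx0.ne', hpos x hx0⟩
  have hnonneg (x : ℝ) : 0 ≤ splitIntegral a I x := by
    by_cases hx : x ≠ 0 ∧ 0 < h + 3 * x * √v
    · rw [hsplit x hx.1 hx.2]
      exact integral_nonneg fun t => abs_nonneg _
    · rw [hzero x hx]
  have hdens : (fun x => ENNReal.ofReal (splitIntegral a I x)) =ᵐ[volume]
      ratioDensity f g D h v := by
    have hne : ∀ᵐ x : ℝ, x ≠ 0 := by simp [ae_iff]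
    refine hne.mono fun x hx => ?_
    simp only
    by_cases he : 0 < h + 3 * x * √v
    · rw [hsplit x hx he, ofReal_integral_eq_lintegral_ofReal (hint x hx he).abs
        (ae_of_all _ fun t => abs_nonneg _),
        ratioDensity_eq_lintegral_ratioRange hfneg hgneg hD hv hx he]
      refine setLIntegral_congr_fun (measurableSet_ratioRange x) fun t ht => ?_
      rw [hI x t hx he ht.1]
    · have hx0 : x < 0 := by
        by_contra! hx0
        exact he (hpos x (lt_of_le_of_ne hx0 hx.symm))
      rw [hzero x fun hcon => he hcon.2, ENNReal.ofReal_zero,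
        ratioDensity_eq_zero hfneg hgneg hD hv hx0 (not_lt.1 he)]
  refine ⟨fun x hx => ?_, fun x hax hx => ?_, ?_, hnonneg, ?_⟩
  · rw [← ratioRange_of_pos hx]
    exact hint x hx.ne' (hpos x hx)
  · rw [← ratioRange_of_neg hx]
    exact hint x hx.ne ((ha x hx).1 hax)
  -- Measurability is inherited from the extended density, with which the split integral agrees
  -- almost everywhere.
  · refine (measurable_ratioDensity hfm hgm D h v).ennreal_toReal.aemeasurable.congr ?_
    refine hdens.mono fun x hx => ?_
    simp only
    rw [← hx, ENNReal.toReal_ofReal (hnonneg x)]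
  · rwa [withDensity_congr_ae hdens]

/-! ### Bounds on `f_K` and `f_Y`, and the normalized index -/

/-- Half of the decay `exp(-k/2)` absorbs `k ^ ((n - 2)/2)`, whose exponent is nonnegative because
`n ≥ 2`. -/
lemma exists_fK_le {n : ℕ} (hn : 2 ≤ n) :
    ∃ C : ℝ, ∀ k, 0 < k → fK n k ≤ C * Real.exp (-k / 4) / √k := by
  have hn' : (2 : ℝ) ≤ n := by exact_mod_cast hn
  set p : ℝ := ((n : ℝ) - 2) / 2 with hp
  have hp0 : 0 ≤ p := by rw [hp]; linarith
  set c : ℝ := (1 / 2) ^ (((n : ℝ) - 1) / 2) / Real.Gamma (((n : ℝ) - 1) / 2)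
  have hc : 0 ≤ c := by
    have := Real.Gamma_pos_of_pos (s := ((n : ℝ) - 1) / 2) (by linarith)
    positivity
  refine ⟨c * (4 * (p + 1)) ^ p, fun k hk => ?_⟩
  have hpow : k ^ p ≤ (4 * (p + 1)) ^ p * Real.exp (k / 4) := by
    -- This is `y ≤ exp y` at `y = k / (4(p + 1))`; using `p + 1` rather than `p` also covers `p =
    -- 0`.
    have h1 : k ≤ 4 * (p + 1) * Real.exp (k / (4 * (p + 1))) := by
      have := Real.add_one_le_exp (k / (4 * (p + 1)))
      calc k = 4 * (p + 1) * (k / (4 * (p + 1))) := by field_simp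
        _ ≤ _ := by gcongr; linarith
    calc k ^ p ≤ (4 * (p + 1) * Real.exp (k / (4 * (p + 1)))) ^ p := by gcongr
      _ = (4 * (p + 1)) ^ p * Real.exp (k / (4 * (p + 1)) * p) := by
        rw [Real.mul_rpow (by positivity) (Real.exp_pos _).le, ← Real.exp_mul]
      _ ≤ _ := by
        gcongr
        calc k / (4 * (p + 1)) * p = k / 4 * (p / (p + 1)) := by field_simp
          _ ≤ k / 4 * 1 := by gcongr; exact div_le_one_of_le₀ (by linarith) (by linarith)
          _ = k / 4 := mul_one _
  have hk1 : k ^ (((n : ℝ) - 1) / 2 - 1) = k ^ p / √k := by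
    rw [Real.sqrt_eq_rpow, ← Real.rpow_sub hk, hp]
    ring_nf
  rw [fK, gammaPDFReal, if_pos hk.le, hk1]
  calc c * (k ^ p / √k) * Real.exp (-(1 / 2 * k))
      ≤ c * ((4 * (p + 1)) ^ p * Real.exp (k / 4) / √k) * Real.exp (-(1 / 2 * k)) := by gcongr
    _ = c * (4 * (p + 1)) ^ p * (Real.exp (k / 4) * Real.exp (-(1 / 2 * k))) / √k := by ring
    _ = _ := by
      rw [← Real.exp_add]
      ring_nf

lemma stdNormalPDF_le_one (x : ℝ) : stdNormalPDF x ≤ 1 := by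
  simp only [stdNormalPDF, gaussianPDFReal, NNReal.coe_one, mul_one]
  have h1 : (1 : ℝ) ≤ √(2 * Real.pi) := Real.one_le_sqrt.2 (by nlinarith [Real.pi_gt_three])
  have h2 : Real.exp (-(x - 0) ^ 2 / 2) ≤ 1 :=
    Real.exp_le_one_iff.2 (by nlinarith [sq_nonneg (x - 0)])
  exact mul_le_one₀ (inv_le_one_of_one_le₀ h1) (Real.exp_pos _).le h2

/-- Besides `φ ≤ 1`, this uses `D_u/d + D_l/d = 2`. -/
lemma fY_le {n : ℕ} {L T U μ σ : ℝ} (hLT : L < T) (hTU : T < U) (y : ℝ) (hy : 0 < y) :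
    fY n L T U μ σ y ≤ 1 / √y := by
  have hd : 0 < halfLength L U := by unfold halfLength; linarith
  have h1 := sub_pos.2 hLT
  have h2 := sub_pos.2 hTU
  rw [fY, if_pos hy]
  calc _ ≤ 1 / (2 * √y) * ((U - T) / halfLength L U * 1 + (T - L) / halfLength L U * 1) := by
        gcongr <;> exact stdNormalPDF_le_one _
    _ = 1 / √y := by
        have : (U - T) / halfLength L U * 1 + (T - L) / halfLength L U * 1 = 2 := by
          rw [mul_one, mul_one, ← add_div, div_eq_iff hd.ne', halfLength]
          ring
        rw [this]
        field_simp

/-- All maxima are positive multiples of `m`. Since the mean lies on one side of `T`, `m ≥ 0`, so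
`√Y` is linear in `m` and the common factor `√n / σ` cancels. -/
lemma indexHat_eq {n : ℕ} (hn : n ≠ 0) {L T U σ : ℝ} (hLT : L < T) (hTU : T < U) (hσ : 0 < σ)
    (u v : ℝ) (x : Fin n → ℝ) :
    indexHat L T U u v x = (DStar n L T U σ - hCoef L T U u * √(YStat L T U σ x)) /
      (3 * √(KStat σ x + v * YStat L T U σ x)) := by
  have hd : 0 < halfLength L U := by unfold halfLength; linarith
  have h1 := sub_pos.2 hLT
  have h2 := sub_pos.2 hTU
  have hds : 0 < dStar L T U := lt_min h2 h1
  have hn' : (0 : ℝ) < n := by exact_mod_cast hn.bot_lt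
  have hsn : 0 < √(n : ℝ) := Real.sqrt_pos.2 hn'
  set m := max ((sampleMean x - T) / (U - T)) ((T - sampleMean x) / (T - L)) with hm
  have hm0 : 0 ≤ m := by
    rcases le_total T (sampleMean x) with h | h
    · exact le_max_of_le_left (div_nonneg (sub_nonneg.2 h) h2.le)
    · exact le_max_of_le_right (div_nonneg (sub_nonneg.2 h) h1.le)
  have hA : AHat L T U x = halfLength L U * m := by
    rw [AHat, hm, mul_max_of_nonneg _ _ hd.le, mul_div_assoc, mul_div_assoc]
  have hAs : AStarHat L T U x = dStar L T U * m := by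
    rw [AStarHat, hm, mul_max_of_nonneg _ _ hds.le, mul_div_assoc, mul_div_assoc]
  have hY : YStat L T U σ x = (√n / σ * (halfLength L U * m)) ^ 2 := by
    rw [YStat, hm, mul_max_of_nonneg _ _ hd.le, mul_max_of_nonneg _ _ (by positivity)]
    congr 2 <;> simp only [ZStat]
    · field_simp
    · field_simp
      ring
  have hsY : √(YStat L T U σ x) = √n / σ * (halfLength L U * m) := by
    rw [hY, Real.sqrt_sq (by positivity)]
  have hden : √(KStat σ x + v * YStat L T U σ x) =
      √n / σ * √(sampleVar x + v * AHat L T U x ^ 2) := by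
    have hsq : √(n : ℝ) ^ 2 = n := Real.sq_sqrt hn'.le
    have : KStat σ x + v * YStat L T U σ x =
        (√n / σ) ^ 2 * (sampleVar x + v * AHat L T U x ^ 2) := by
      rw [hY, hA, KStat, div_pow, hsq, mul_pow, div_pow, hsq]
      ring
    rw [this, Real.sqrt_mul (sq_nonneg _), Real.sqrt_sq (by positivity)]
  rw [indexHat, hden, hsY, hAs, DStar, hCoef]
  have hnum : √n * dStar L T U / σ - u * dStar L T U / halfLength L U *
      (√n / σ * (halfLength L U * m)) =
      √n / σ * (dStar L T U - u * (dStar L T U * m)) := by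
    field_simp
  rw [hnum, mul_left_comm 3, mul_div_mul_left _ _ (by positivity)]

end Capability

/-! ### The density of the estimated index -/

theorem mainTheorem4 {Ω : Type*} [MeasurableSpace Ω] (P : Measure Ω) [IsProbabilityMeasure P]
    (n : ℕ) (hn : 2 ≤ n) (L T U μ σ : ℝ) (hLT : L < T) (hTU : T < U) (hσ : 0 < σ)
    (X : Fin n → Ω → ℝ)
    (hX : ∀ i, HasLaw (X i) (gaussianReal μ (Real.toNNReal (σ ^ 2))) P)
    (hindep : iIndepFun X P) :
    -- the functions `f_K` and `f_Y` are the densities of the statistics `K` and `Y`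
    HasDensity P (fun ω => KStat σ (fun i => X i ω)) (fK n) ∧
    HasDensity P (fun ω => YStat L T U σ (fun i => X i ω)) (fY n L T U μ σ) ∧
    -- the general case
    (∀ u v : ℝ, 0 < u → 0 < v →
      HasSplitIntegralDensity P (fun ω => indexHat L T U u v (fun i => X i ω))
        ((-hCoef L T U u / (3 * √v) : ℝ) : EReal) (J n L T U μ σ u v)) ∧
    -- the general expression remains valid when exactly one of `u`, `v` vanishes
    (∀ u v : ℝ, (0 < u ∧ v = 0) ∨ (u = 0 ∧ 0 < v) →
      HasSplitIntegralDensity P (fun ω => indexHat L T U u v (fun i => X i ω))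
        (leftEnd (hCoef L T U u) v) (J n L T U μ σ u v)) ∧
    -- the case `v = 0`
    (∀ u : ℝ, 0 < u →
      (∀ x : ℝ, Kfun n L T U σ u 0 x = (DStar n L T U σ / hCoef L T U u) ^ 2) ∧
      (DStar n L T U σ / hCoef L T U u) ^ 2 = (DBig n L U σ / u) ^ 2 ∧
      HasSplitIntegralDensity P (fun ω => indexHat L T U u 0 (fun i => X i ω))
        ⊥ (J₁ n L T U μ σ u)) ∧
    -- the case `u = 0`, where the density vanishes on the negative half-line
    (∀ v : ℝ, 0 < v →
      (∀ x : ℝ, Kfun n L T U σ 0 v x = (DStar n L T U σ / (3 * x * √v)) ^ 2) ∧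
      HasSplitIntegralDensity P (fun ω => indexHat L T U 0 v (fun i => X i ω))
        0 (J₂ n L T U μ σ v)) := by
  have hn0 : n ≠ 0 := by omega
  have hn' : (2 : ℝ) ≤ n := by exact_mod_cast hn
  have hd : 0 < halfLength L U := by unfold halfLength; linarith
  have hds : 0 < dStar L T U := lt_min (sub_pos.2 hTU) (sub_pos.2 hLT)
  have hsn : 0 < √(n : ℝ) := Real.sqrt_pos.2 (by linarith)
  have hD : 0 < DStar n L T U σ := by unfold DStar; positivity
  have hshape : 0 < ((n : ℝ) - 1) / 2 := by linarith
  obtain ⟨hZ, hK, hKZ⟩ := hasLaw_ZStat_KStat (T := T) hn hσ hX hindep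
  have hY := hasLaw_YStat hLT hTU hZ
  have hfm : Measurable (fK n) := measurable_gammaPDFReal _ _
  have hf0 : ∀ k, 0 ≤ fK n k := gammaPDFReal_nonneg hshape (by norm_num)
  have hfneg : ∀ k < 0, fK n k = 0 := fun k hk => by rw [fK, gammaPDFReal, if_neg hk.not_ge]
  have hgm := measurable_fY n L T U μ σ
  have hg0 := fY_nonneg (n := n) (μ := μ) (σ := σ) hLT hTU
  have hgneg : ∀ y ≤ 0, fY n L T U μ σ y = 0 := fun y hy => by rw [fY, if_neg hy.not_gt]
  obtain ⟨C, hC⟩ := exists_fK_le hn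
  have hKY : IndepFun (fun ω => KStat σ fun i => X i ω) (fun ω => YStat L T U σ fun i => X i ω) P :=
    hKZ.comp (φ := id) (ψ := fun z => max (halfLength L U / (U - T) * z)
      (-(halfLength L U / (T - L)) * z) ^ 2) measurable_id (by fun_prop)
  have hh {u : ℝ} (hu : 0 < u) : 0 < hCoef L T U u := by unfold hCoef; positivity
  have hh0 : hCoef L T U 0 = 0 := by simp [hCoef]
  -- Every case passes through this statement. Agreement with `J` is required only for `x ≠ 0` and
  -- `t > 0`, so the simplified integrands may replace it.
  have key {u v : ℝ} (hu : 0 ≤ u) (hv : 0 ≤ v) (huv : 0 < u ∨ 0 < v) {I : ℝ → ℝ → ℝ} {a : EReal}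
      (ha : a = leftEnd (hCoef L T U u) v)
      (hI : ∀ x t, x ≠ 0 → 0 < t → I x t = J n L T U μ σ u v x t) :
      HasSplitIntegralDensity P (fun ω => indexHat L T U u v (fun i => X i ω)) a I := by
    have hW := hasLaw_ratio hfm hgm hf0 hg0 hfneg (fun y hy => hgneg y hy.le) hK hY hKY
      (h := hCoef L T U u) hD.ne' hv
    simp_rw [← indexHat_eq hn0 hLT hTU hσ u v] at hW
    have hhu : 0 ≤ hCoef L T U u := by unfold hCoef; positivity
    refine hasSplitIntegralDensity_ratio hfm hgm hf0 hg0 hfneg hgneg hC (fY_le hLT hTU) hD hhu hv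
      (huv.imp_left hh) hW ?_ ?_
    · intro x hx
      rw [ha, leftEnd]
      split_ifs with hv0
      · have hu' : 0 < u := huv.resolve_right (by simp [hv0])
        simp [hv0, hh hu', EReal.bot_lt_coe]
      · have hsv : 0 < √v := Real.sqrt_pos.2 (lt_of_le_of_ne hv (Ne.symm hv0))
        rw [EReal.coe_lt_coe_iff, div_lt_iff₀ (by positivity)]
        constructor <;> intro h <;> linarith
    · intro x t hx he ht
      -- The factor `K(x)` in `2K(x)/x` is the Jacobian of `y = t K(x)`.
      rw [hI x t hx ht, J, ratioKernel, Kfun]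
      ring_nf
  refine ⟨⟨hfm.aemeasurable, hf0, hK⟩, ⟨hgm.aemeasurable, hg0, hY⟩, fun u v hu hv => ?_,
    fun u v huv => ?_, fun u hu => ⟨fun x => ?_, ?_, ?_⟩, fun v hv => ⟨fun x => ?_, ?_⟩⟩
  · exact key hu.le hv.le (Or.inl hu) (by rw [leftEnd, if_neg hv.ne']) fun _ _ _ _ => rfl
  · rcases huv with ⟨hu, rfl⟩ | ⟨rfl, hv⟩
    · exact key hu.le le_rfl (Or.inl hu) rfl fun _ _ _ _ => rfl
    · exact key le_rfl hv.le (Or.inr hv) rfl fun _ _ _ _ => rfl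
  · simp [Kfun]
  · rw [DStar, hCoef, DBig]
    field_simp
  · refine key hu.le le_rfl (Or.inl hu) (by simp [leftEnd]) fun x t hx ht => ?_
    have hK0 : Kfun n L T U σ u 0 x = (DStar n L T U σ / hCoef L T U u) ^ 2 := by simp [Kfun]
    have hDu : DBig n L U σ / u = DStar n L T U σ / hCoef L T U u := by
      rw [DStar, hCoef, DBig]
      field_simp
    have hs : hCoef L T U u * √(t * (DStar n L T U σ / hCoef L T U u) ^ 2) =
        DStar n L T U σ * √t := by
      have := hh hu
      rw [Real.sqrt_mul ht.le, Real.sqrt_sq (by positivity)]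
      field_simp
    rw [J₁, J, hK0, hs, hDu, zero_mul, zero_mul, sub_zero,
      mul_comm ((DStar n L T U σ / hCoef L T U u) ^ 2) t, mul_one_sub]
    ring
  · simp [Kfun, hh0]
  -- With `h = 0` the left end point is 0, so the negative branch is empty.
  · refine key le_rfl hv.le (Or.inr hv) (by simp [leftEnd, hv.ne', hh0]) fun x t hx ht => ?_
    have hK0 : Kfun n L T U σ 0 v x = (DStar n L T U σ / (3 * x)) ^ 2 / v := by
      rw [Kfun, hh0, zero_add, ← div_div, div_pow _ (√v), Real.sq_sqrt hv.le]
    rw [J₂, J, hK0, hh0, zero_mul, sub_zero]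
    have e1 : (DStar n L T U σ / (3 * x)) ^ 2 - v * t * ((DStar n L T U σ / (3 * x)) ^ 2 / v) =
        (DStar n L T U σ / (3 * x)) ^ 2 * (1 - t) := by
      field_simp
    have e2 : t * ((DStar n L T U σ / (3 * x)) ^ 2 / v) =
        (DStar n L T U σ / (3 * x)) ^ 2 * (t / v) := by ring
    rw [e1, e2]
    field_simp
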